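/- Let $M$ be a closed (i.e. compact, without boundary) smooth $n$-manifold with a smooth Riemannian metric and associated Riemannian volume measure $\mu$, and let $E$ be a smooth complex vector bundle over $M$ of rank $r\ge 1$. Let $\Gamma(\mathrm{Herm}(E))$ be the Fréchet space (with the smooth compact-open topology) of smooth sections of the bundle of Hermitian sesquilinear forms on the fibres of $E$, and let $\Gamma(\mathrm{Herm}^+(E))\subseteq\Gamma(\mathrm{Herm}(E))$ be the set of smooth Hermitian metrics on $E$. Fix a real constant $\alpha>-1/r$. For $h\in\Gamma(\mathrm{Herm}^+(E))$ and $v,w\in\Gamma(\mathrm{Herm}(E))$ put $$(v,w)_h^{\alpha}=\int_M\Big(\operatorname{tr}(h^{-1}v\,h^{-1}w)+\alpha\operatorname{tr}(h^{-1}v)\operatorname{tr}(h^{-1}w)\Big)\,d\mu,$$ where $h^{-1}v\in\mathrm{End}(E)$ is defined by $v(a,b)=h(a,(h^{-1}v)b)$, and let $d(h_0,h_1)$ be the infimum of the lengths $$L(\gamma)=\int_0^1\sqrt{(\dot\gamma(t),\dot\gamma(t))^{\alpha}_{\gamma(t)}}\,dt$$ over all piecewise $C^1$ paths $\gamma:[0,1]\to\Gamma(\mathrm{Herm}^+(E))$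 from $h_0$ to $h_1$. Then for every $h\in\Gamma(\mathrm{Herm}^+(E))$ and all smooth functions $f,g:M\to\mathbb{R}$, $$d(e^{f}h,e^{g}h)=\sqrt{r(1+\alpha r)}\,\Big(\int_M|f-g|^2\,d\mu\Big)^{1/2}.$$ -/

import Mathlib

open Set Filter Topology MeasureTheory Bundle
open scoped Manifold ContDiff ENNReal ComplexConjugate

noncomputable section

/-! ### Linear algebra of Hermitian forms -/

/-- Sesquilinear forms on a complex vector space, linear in the first argument and conjugate linear
in the second one. -/
abbrev SesqForm (W : Type*) [AddCommGroup W] [Module ℂ W] := W →ₗ[ℂ] W →ₗ⋆[ℂ] ℂ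

/-- A Hermitian sesquilinear form. -/
def SesqForm.IsHermitian {W : Type*} [AddCommGroup W] [Module ℂ W] (v : SesqForm W) : Prop :=
  ∀ a b, v a b = conj (v b a)

/-- A positive definite sesquilinear form. For a Hermitian form `h` the number `h a a` is real. -/
def SesqForm.IsPosDef {W : Type*} [AddCommGroup W] [Module ℂ W] (h : SesqForm W) : Prop :=
  ∀ a, a ≠ 0 → 0 < (h a a).re

open Classical in
/-- The endomorphism `h⁻¹v`, characterized by `v a b = h a ((h⁻¹v) b)` whenever `h` is
nondegenerate: the composition of `b ↦ v (·, b)` with the inverse of `b ↦ h (·, b)`. -/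
def SesqForm.invMul {W : Type*} [AddCommGroup W] [Module ℂ W] (h v : SesqForm W) :
    Module.End ℂ W :=
  if hh : Function.Bijective h.flip then
    (LinearEquiv.ofBijective h.flip hh).symm.toLinearMap ∘ₛₗ v.flip
  else 0

/-- The defining property of `h⁻¹v` for a positive definite form `h`. -/
theorem SesqForm.apply_invMul {W : Type*} [AddCommGroup W] [Module ℂ W] [FiniteDimensional ℂ W]
    {h : SesqForm W} (hpos : h.IsPosDef) (v : SesqForm W) (a b : W) :
    h a (h.invMul v b) = v a b := by
  have hinj : Function.Injective h.flip := by
    rw [injective_iff_map_eq_zero]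
    intro b hb
    by_contra hne
    have h1 := hpos b hne
    have h2 : h b b = 0 := by
      rw [← LinearMap.flip_apply, hb, LinearMap.zero_apply]
    simp [h2] at h1
  have hb : Function.Bijective h.flip := by
    refine ⟨hinj, ?_⟩
    let φ : W →ₗ[ℝ] Module.Dual ℂ W :=
      { toFun := h.flip
        map_add' := map_add _
        map_smul' := fun c x => by
          have := h.flip.map_smulₛₗ (c : ℂ) x
          simpa using this }
    have : FiniteDimensional ℝ W := FiniteDimensional.trans ℝ ℂ W
    have : FiniteDimensional ℝ (Module.Dual ℂ W) := FiniteDimensional.trans ℝ ℂ _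
    have hr : Module.finrank ℝ W = Module.finrank ℝ (Module.Dual ℂ W) := by
      rw [finrank_real_of_complex, finrank_real_of_complex, Subspace.dual_finrank_eq]
    exact (LinearMap.injective_iff_surjective_of_finrank_eq_finrank (f := φ) hr).1 hinj
  have key : h.flip (h.invMul v b) = v.flip b := by
    rw [SesqForm.invMul, dif_pos hb]
    exact (LinearEquiv.ofBijective h.flip hb).apply_symm_apply (v.flip b)
  have := LinearMap.congr_fun key a
  simpa using this

/-- The pointwise inner product `tr (h⁻¹v h⁻¹w) + α tr (h⁻¹v) tr (h⁻¹w)`. For Hermitian `v`, `w` and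
positive definite Hermitian `h` all the traces involved are real. -/
def SesqForm.innerAt {W : Type*} [AddCommGroup W] [Module ℂ W] (α : ℝ) (h v w : SesqForm W) : ℝ :=
  (LinearMap.trace ℂ W (h.invMul v * h.invMul w)).re
    + α * ((LinearMap.trace ℂ W (h.invMul v)).re * (LinearMap.trace ℂ W (h.invMul w)).re)

/-! ### The Riemannian volume measure -/

section Volume

variable {n : ℕ} {M : Type*} [TopologicalSpace M] [ChartedSpace (EuclideanSpace ℝ (Fin n)) M]
  [IsManifold (𝓡 n) ∞ M]

/-- A smooth Riemannian metric on an `n`-manifold `M`. -/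
abbrev SmoothRiemannianMetric (n : ℕ) (M : Type*) [TopologicalSpace M]
    [ChartedSpace (EuclideanSpace ℝ (Fin n)) M] [IsManifold (𝓡 n) ∞ M] :=
  ContMDiffRiemannianMetric (𝓡 n) ∞ (EuclideanSpace ℝ (Fin n))
    (fun x : M => TangentSpace (𝓡 n) x)

/-- The coordinate vector field `∂ᵢ` of the chart at `p`, at the point with coordinates `u`. -/
def coordVector (p : M) (u : EuclideanSpace ℝ (Fin n)) (i : Fin n) :
    TangentSpace (𝓡 n) ((chartAt (EuclideanSpace ℝ (Fin n)) p).symm u) :=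
  mfderiv 𝓘(ℝ, EuclideanSpace ℝ (Fin n)) (𝓡 n) (chartAt (EuclideanSpace ℝ (Fin n)) p).symm u
    (EuclideanSpace.single i (1 : ℝ))

/-- The density `√(det gᵢⱼ)` in the chart at `p`, with `gᵢⱼ = g (∂ᵢ, ∂ⱼ)`. -/
def chartDensity (g : SmoothRiemannianMetric n M) (p : M) (u : EuclideanSpace ℝ (Fin n)) : ℝ :=
  Real.sqrt (Matrix.det (Matrix.of fun i j : Fin n =>
    g.inner ((chartAt (EuclideanSpace ℝ (Fin n)) p).symm u) (coordVector p u i)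
      (coordVector p u j)))

variable [MeasurableSpace M]

/-- The measure `√(det gᵢⱼ) du¹ ⋯ duⁿ` on the domain of the chart at `p`, as a measure on `M`. -/
def chartVolume (g : SmoothRiemannianMetric n M) (p : M) : Measure M :=
  Measure.map (chartAt (EuclideanSpace ℝ (Fin n)) p).symm
    ((volume.restrict (chartAt (EuclideanSpace ℝ (Fin n)) p).target).withDensity
      fun u => ENNReal.ofReal (chartDensity g p u))

/-- The volume of a set that is contained in a chart domain, computed in such a chart (by the
change of variables formula any such chart gives the same value), and `∞` for all other sets. -/
def localVolume (g : SmoothRiemannianMetric n M) (A : Set M) : ℝ≥0∞ :=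
  ⨅ (p : M) (_ : A ⊆ (chartAt (EuclideanSpace ℝ (Fin n)) p).source), chartVolume g p A

theorem borel_le_caratheodory_localVolume (g : SmoothRiemannianMetric n M) :
    ‹MeasurableSpace M› ≤ (OuterMeasure.boundedBy (localVolume g)).caratheodory := by
  intro s hs
  refine OuterMeasure.boundedBy_caratheodory fun t => ?_
  refine le_iInf₂ fun p hp => ?_
  rw [← measure_inter_add_sdiff t hs]
  exact add_le_add
    (iInf₂_le_of_le p (inter_subset_left.trans hp) le_rfl)
    (iInf₂_le_of_le p (sdiff_subset.trans hp) le_rfl)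

/-- The Riemannian volume measure `μ_g`: the measure that is given by `√(det gᵢⱼ) du¹ ⋯ duⁿ` in
every chart. A set `A` has measure `inf ∑ₖ vol (Aₖ)`, the infimum being over all countable covers
of `A` by sets `Aₖ` each of which lies in a chart domain. -/
def riemannianVolume (g : SmoothRiemannianMetric n M) : Measure M :=
  (OuterMeasure.boundedBy (localVolume g)).toMeasure (borel_le_caratheodory_localVolume g)

end Volume

/-! ### Smooth complex vector bundles and their Hermitian forms -/

/-- A complex vector bundle of rank `r` over the real manifold `M` is smooth if its transition
functions are smooth. -/
class IsSmoothComplexVectorBundle (n r : ℕ) {M : Type*} [TopologicalSpace M]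
    [ChartedSpace (EuclideanSpace ℝ (Fin n)) M] (V : M → Type*)
    [TopologicalSpace (TotalSpace (EuclideanSpace ℂ (Fin r)) V)] [∀ x, TopologicalSpace (V x)]
    [∀ x, AddCommGroup (V x)] [∀ x, Module ℂ (V x)] [FiberBundle (EuclideanSpace ℂ (Fin r)) V]
    [VectorBundle ℂ (EuclideanSpace ℂ (Fin r)) V] : Prop where
  contMDiffOn_coordChangeL :
    ∀ (e e' : Trivialization (EuclideanSpace ℂ (Fin r))
        (π (EuclideanSpace ℂ (Fin r)) V)) [MemTrivializationAtlas e] [MemTrivializationAtlas e'],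
      ContMDiffOn (𝓡 n) 𝓘(ℝ, EuclideanSpace ℂ (Fin r) →L[ℂ] EuclideanSpace ℂ (Fin r)) ∞
        (fun b : M => (e.coordChangeL ℂ e' b :
          EuclideanSpace ℂ (Fin r) →L[ℂ] EuclideanSpace ℂ (Fin r)))
        (e.baseSet ∩ e'.baseSet)

section Bundle

variable {n r : ℕ} {M : Type*} [TopologicalSpace M] [ChartedSpace (EuclideanSpace ℝ (Fin n)) M]
  {V : M → Type*} [TopologicalSpace (TotalSpace (EuclideanSpace ℂ (Fin r)) V)]
  [∀ x, TopologicalSpace (V x)] [∀ x, AddCommGroup (V x)] [∀ x, Module ℂ (V x)]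
  [FiberBundle (EuclideanSpace ℂ (Fin r)) V] [VectorBundle ℂ (EuclideanSpace ℂ (Fin r)) V]

/-- The `(i, j)` entry of the matrix of a family `s` of sesquilinear forms on the fibres, in the
local frame given by the trivialization `e`. -/
def localEntry (e : Trivialization (EuclideanSpace ℂ (Fin r)) (π (EuclideanSpace ℂ (Fin r)) V))
    (i j : Fin r) (s : ∀ x, SesqForm (V x)) (x : M) : ℂ :=
  s x (e.symm x (EuclideanSpace.single i 1)) (e.symm x (EuclideanSpace.single j 1))

variable (n r V) in
/-- The real vector space `Γ(Herm(E))` of smooth sections of the bundle of Hermitian forms on the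
fibres: families of Hermitian forms whose matrix entries in the local frames are smooth. -/
def hermSections : Submodule ℝ (∀ x, SesqForm (V x)) where
  carrier := {s | (∀ x, (s x).IsHermitian) ∧
    ∀ e ∈ FiberBundle.trivializationAtlas (EuclideanSpace ℂ (Fin r)) V, ∀ i j : Fin r,
      ContMDiffOn (𝓡 n) 𝓘(ℝ, ℂ) ∞ (localEntry e i j s) e.baseSet}
  add_mem' {s t} hs ht := by
    refine ⟨fun x a b => ?_, fun e he i j => (hs.2 e he i j).add (ht.2 e he i j)⟩
    simp [hs.1 x a b, ht.1 x a b]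
  zero_mem' := ⟨fun x a b => by simp, fun e he i j => contMDiffOn_const (c := (0 : ℂ))⟩
  smul_mem' c s hs := by
    refine ⟨fun x a b => ?_, fun e he i j => ?_⟩
    · simp [hs.1 x a b]
    · exact (contMDiffOn_const (I' := 𝓘(ℝ, ℝ)) (c := c)).smul (hs.2 e he i j)

variable (n r V) in
/-- The space `Γ(Herm(E))`, also the tangent space of `Γ(Herm⁺(E))` at each point. -/
abbrev HermSection := ↥(hermSections n r V)

/-- The region, in the chart at `p`, over which the trivialization `e` is defined. -/
def coordDomain (n : ℕ) {r : ℕ} {M : Type*} [TopologicalSpace M]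
    [ChartedSpace (EuclideanSpace ℝ (Fin n)) M]
    {V : M → Type*} [TopologicalSpace (TotalSpace (EuclideanSpace ℂ (Fin r)) V)]
    (e : Trivialization (EuclideanSpace ℂ (Fin r)) (π (EuclideanSpace ℂ (Fin r)) V)) (p : M) :
    Set (EuclideanSpace ℝ (Fin n)) :=
  (chartAt (EuclideanSpace ℝ (Fin n)) p).target ∩
    (chartAt (EuclideanSpace ℝ (Fin n)) p).symm ⁻¹' e.baseSet

/-- The smooth compact-open topology on `Γ(Herm(E))`: uniform convergence, on compact subsets of
coordinate domains, of all the derivatives of the coordinate expressions. -/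
instance HermSection.instTopologicalSpace : TopologicalSpace (HermSection n r V) :=
  ⨅ (e : FiberBundle.trivializationAtlas (EuclideanSpace ℂ (Fin r)) V) (p : M) (i : Fin r)
    (j : Fin r) (k : ℕ),
    TopologicalSpace.induced
      (fun s : HermSection n r V =>
        UniformOnFun.ofFun {K | IsCompact K ∧ K ⊆ coordDomain n e.1 p}
          (iteratedFDeriv ℝ k fun u : EuclideanSpace ℝ (Fin n) =>
            localEntry e.1 i j s.1 ((chartAt (EuclideanSpace ℝ (Fin n)) p).symm u)))
      inferInstance

variable (n r V) in
/-- The space `Γ(Herm⁺(E))` of smooth Hermitian metrics on `E`. -/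
structure HermMetric where
  /-- the underlying section of `Herm(E)` -/
  form : HermSection n r V
  isPosDef : ∀ x, (form.1 x).IsPosDef

/-- The Hermitian metric `e^f h`, for a smooth function `f`. -/
def HermMetric.expMul (f : C^∞⟮𝓡 n, M; 𝓘(ℝ, ℝ), ℝ⟯) (h : HermMetric n r V) :
    HermMetric n r V where
  form := ⟨fun x => Real.exp (f x) • h.form.1 x, by
    refine ⟨fun x a b => ?_, fun e he i j => ?_⟩
    · simp only [LinearMap.smul_apply, Complex.real_smul, map_mul, Complex.conj_ofReal]
      rw [h.form.2.1 x a b]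
    · exact (Real.contDiff_exp.comp_contMDiff f.contMDiff).contMDiffOn.smul
        (h.form.2.2 e he i j)⟩
  isPosDef x a ha := by
    have h1 := mul_pos (Real.exp_pos (f x)) (h.isPosDef x a ha)
    rwa [← Complex.re_ofReal_mul, ← Complex.real_smul] at h1

/-! ### Paths, lengths and the distance -/

/-- The curve `γ` in the topological vector space `Γ(Herm(E))` is of class `C¹` on `[a, b]`, with
derivative `v`. -/
structure IsC1On (γ v : ℝ → HermSection n r V) (a b : ℝ) : Prop where
  tendsto_slope : ∀ t ∈ Icc a b, Tendsto (slope γ t) (𝓝[Icc a b \ {t}] t) (𝓝 (v t))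
  continuousOn : ContinuousOn v (Icc a b)

/-- A piecewise `C¹` path `[0, 1] → Γ(Herm⁺(E))` from `h₀` to `h₁`. -/
structure HermPath (h₀ h₁ : HermMetric n r V) where
  /-- the path (only its restriction to `[0, 1]` matters) -/
  toFun : ℝ → HermSection n r V
  /-- the derivative of the path, away from the finitely many break points -/
  velocity : ℝ → HermSection n r V
  source : toFun 0 = h₀.form
  target : toFun 1 = h₁.form
  isPosDef : ∀ t ∈ Icc (0 : ℝ) 1, ∀ x, ((toFun t).1 x).IsPosDef
  piecewise : ∃ (N : ℕ) (τ : ℕ → ℝ), τ 0 = 0 ∧ τ N = 1 ∧ ∀ k < N, τ k < τ (k + 1) ∧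
    ∃ v : ℝ → HermSection n r V, IsC1On toFun v (τ k) (τ (k + 1)) ∧
      EqOn velocity v (Ioo (τ k) (τ (k + 1)))

variable [IsManifold (𝓡 n) ∞ M] [MeasurableSpace M]

/-- The weak Riemannian metric
`(v, w)_h = ∫_M (tr (h⁻¹v h⁻¹w) + α tr (h⁻¹v) tr (h⁻¹w)) dμ_g`. -/
def l2Inner (g : SmoothRiemannianMetric n M) (α : M → ℝ) (h v w : HermSection n r V) : ℝ :=
  ∫ x, SesqForm.innerAt (α x) (h.1 x) (v.1 x) (w.1 x) ∂(riemannianVolume g)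

/-- The length `∫₀¹ ‖γ'(t)‖_{γ(t)} dt` of a path. -/
def HermPath.length (g : SmoothRiemannianMetric n M) (α : M → ℝ) {h₀ h₁ : HermMetric n r V}
    (γ : HermPath h₀ h₁) : ℝ :=
  ∫ t in (0 : ℝ)..1, Real.sqrt (l2Inner g α (γ.toFun t) (γ.velocity t) (γ.velocity t))

/-- The distance function `d` on `Γ(Herm⁺(E))`: the infimum of the lengths of the piecewise `C¹`
paths between two points. -/
def hermDist (g : SmoothRiemannianMetric n M) (α : M → ℝ) (h₀ h₁ : HermMetric n r V) : ℝ :=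
  ⨅ γ : HermPath h₀ h₁, γ.length g α

end Bundle

end

/-! Everything is controlled by the logarithm of the determinant. By Jacobi's formula `tr (h⁻¹v)` is
the derivative of `log det h` in the direction `v`. The operator `h⁻¹v` is self-adjoint for `h`, so
Cauchy–Schwarz for its trace gives `tr ((h⁻¹v)²) ≥ (tr (h⁻¹v))² / r`, and the pointwise metric is at
least `(1/r + α) (tr (h⁻¹v))²` (`SesqForm.le_innerAt`). Hence every path is at least `√(1/r + α)`
times as long as the `L²` displacement of `log det`.

Between `e^{f₁} h` and `e^{f₂} h` that displacement is `r (f₂ - f₁)`, and `√(1/r + α) r = √(r (1 + α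
r))`, which gives the lower bound (`HermPath.le_length_expMul`). Equality in Cauchy–Schwarz means
that `h⁻¹v` is scalar, as happens along `t ↦ e^{f₁ + t (f₂ - f₁)} h`; this path attains the bound
(`length_conformalPath`).

The `L²` displacement is measured by pairing with a fixed continuous `φ` and taking `φ = f₂ - f₁` at
the end. The pairing is linear, so the pieces of a path simply add up. The function `log det`
depends on a frame, chosen separately at each point and hence possibly discontinuous in `x`. Only
differences in time occur, and these are integrals of the trace, which is frame independent and
jointly continuous in `(t, x)`.

For the lower bound, only uniform convergence of order zero is needed from the topology on sections.
All derivatives matter when the conformal path is shown to be `C¹`. -/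

noncomputable section

section

open scoped ComplexOrder Matrix

/-! ### Matrices of Hermitian forms -/

/-- **Jacobi's formula** for the derivative of a determinant. -/
theorem Matrix.hasDerivWithinAt_det {ι : Type*} [Fintype ι] [DecidableEq ι]
    {A : ℝ → Matrix ι ι ℂ} {A' : Matrix ι ι ℂ} {s : Set ℝ} {t : ℝ}
    (hA : ∀ i j, HasDerivWithinAt (fun τ => A τ i j) (A' i j) s t) :
    HasDerivWithinAt (fun τ => (A τ).det) (((A t).adjugate * A').trace) s t := by
  have h1 : HasDerivWithinAt (fun τ => ∑ σ : Equiv.Perm ι,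
      (σ.sign : ℤ) • ∏ i, A τ (σ i) i)
      (∑ σ : Equiv.Perm ι, (σ.sign : ℤ) •
        ∑ i, (∏ j ∈ Finset.univ.erase i, A t (σ j) j) • A' (σ i) i) s t := by
    refine HasDerivWithinAt.fun_sum fun σ _ => ?_
    exact (HasDerivWithinAt.fun_finsetProd fun i _ => hA (σ i) i).const_smul (σ.sign : ℤ)
  have h2 : (∑ σ : Equiv.Perm ι, (σ.sign : ℤ) •
        ∑ i, (∏ j ∈ Finset.univ.erase i, A t (σ j) j) • A' (σ i) i) =
      ((A t).adjugate * A').trace := by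
    -- Cramer's rule: each diagonal entry is the determinant with one column differentiated, which
    -- is what the Leibniz rule produces.
    have h3 : ∀ i, ((A t).adjugate * A') i i = ((A t).updateCol i (fun k => A' k i)).det := by
      intro i
      rw [← Matrix.cramer_apply, Matrix.cramer_eq_adjugate_mulVec]
      rfl
    simp only [Matrix.trace, Matrix.diag_apply, h3, Matrix.det_apply, Finset.smul_sum]
    rw [Finset.sum_comm]
    refine Finset.sum_congr rfl fun i _ => Finset.sum_congr rfl fun σ _ => ?_
    rw [← Finset.mul_prod_erase _ _ (Finset.mem_univ i)]
    simp only [Matrix.updateCol_self, smul_eq_mul]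
    rw [mul_comm]
    congr 2
    refine Finset.prod_congr rfl fun j hj => ?_
    rw [Matrix.updateCol_ne (Finset.ne_of_mem_erase hj)]
  rw [← h2]
  refine h1.congr (fun τ _ => ?_) ?_ <;> rw [Matrix.det_apply] <;> rfl

theorem Matrix.PosDef.det_re_pos {ι : Type*} [Fintype ι] [DecidableEq ι] {A : Matrix ι ι ℂ}
    (hA : A.PosDef) : 0 < A.det.re := (Complex.lt_def.1 hA.det_pos).1

theorem Matrix.PosDef.det_im {ι : Type*} [Fintype ι] [DecidableEq ι] {A : Matrix ι ι ℂ}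
    (hA : A.PosDef) : A.det.im = 0 := (Complex.lt_def.1 hA.det_pos).2.symm

theorem Matrix.hasDerivWithinAt_log_re_det {ι : Type*} [Fintype ι] [DecidableEq ι]
    {A : ℝ → Matrix ι ι ℂ} {A' : Matrix ι ι ℂ} {s : Set ℝ} {t : ℝ} (hpos : (A t).PosDef)
    (hA : ∀ i j, HasDerivWithinAt (fun τ => A τ i j) (A' i j) s t) :
    HasDerivWithinAt (fun τ => Real.log (A τ).det.re) (((A t)⁻¹ * A').trace.re) s t := by
  have h1 := Matrix.hasDerivWithinAt_det hA
  have h2 : HasDerivWithinAt (fun τ => (A τ).det.re) (((A t).adjugate * A').trace.re) s t :=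
    Complex.reCLM.hasFDerivAt.comp_hasDerivWithinAt t h1
  have h3 := h2.log hpos.det_re_pos.ne'
  convert h3 using 1
  -- The determinant is real, so it factors out of the real part and cancels the denominator of the
  -- logarithmic derivative.
  have hadj : (A t).adjugate = (A t).det • (A t)⁻¹ := by
    rw [Matrix.inv_def, smul_smul, Ring.mul_inverse_cancel _ hpos.det_pos.ne'.isUnit, one_smul]
  rw [hadj, Matrix.smul_mul, Matrix.trace_smul, smul_eq_mul, Complex.mul_re, hpos.det_im]
  have := hpos.det_re_pos.ne'
  field_simp
  simp

/-- The Cauchy–Schwarz inequality `(tr (A⁻¹B))² ≤ n tr ((A⁻¹B)²)`. -/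
theorem Matrix.PosDef.trace_inv_mul_sq_le {ι : Type*} [Fintype ι] [DecidableEq ι]
    {A B : Matrix ι ι ℂ} (hA : A.PosDef) (hB : B.IsHermitian) :
    (A⁻¹ * B).trace.re ^ 2 ≤ Fintype.card ι * (A⁻¹ * B * (A⁻¹ * B)).trace.re := by
  -- `A⁻¹B` need not be Hermitian. Factoring `A⁻¹ = C Cᴴ` and moving `C` around the trace replaces
  -- it by the Hermitian matrix `Cᴴ B C`.
  obtain ⟨C, hC⟩ : ∃ C : Matrix ι ι ℂ, A⁻¹ = C * Cᴴ := by
    open scoped MatrixOrder in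
    obtain ⟨y, hy⟩ := CStarAlgebra.nonneg_iff_eq_star_mul_self.mp hA.inv.posSemidef.nonneg
    exact ⟨star y, by rw [hy, ← Matrix.star_eq_conjTranspose, star_star]⟩
  set S := Cᴴ * B * C with hS
  have hSh : S.IsHermitian := by
    simp [Matrix.IsHermitian, hS, Matrix.conjTranspose_mul, hB.eq, Matrix.mul_assoc]
  have h1 : (A⁻¹ * B).trace = S.trace := by
    rw [hC, hS, Matrix.mul_assoc, Matrix.trace_mul_comm]
  have h2 : (A⁻¹ * B * (A⁻¹ * B)).trace = (S * S).trace := by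
    rw [hC, hS, Matrix.mul_assoc C, Matrix.mul_assoc C, Matrix.trace_mul_comm]
    simp only [Matrix.mul_assoc]
  rw [h1, h2]
  have h3 : (S * S).trace.re = ∑ i, ∑ j, Complex.normSq (S i j) := by
    simp only [Matrix.trace, Matrix.diag_apply, Matrix.mul_apply, Complex.re_sum]
    refine Finset.sum_congr rfl fun i _ => Finset.sum_congr rfl fun j _ => ?_
    rw [← hSh.apply j i, Complex.star_def, Complex.mul_conj, Complex.ofReal_re]
  have h4 : S.trace.re = ∑ i, (S i i).re := by
    simp [Matrix.trace, Complex.re_sum]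
  -- Cauchy–Schwarz is needed on the diagonal only; the off-diagonal entries contribute nonnegative
  -- terms to `tr (S²)` and are dropped.
  have h5 := sq_sum_le_card_mul_sum_sq (s := (Finset.univ : Finset ι)) (f := fun i => (S i i).re)
  rw [h3, h4]
  refine h5.trans (mul_le_mul_of_nonneg_left (Finset.sum_le_sum fun i _ => ?_) (by positivity))
  refine le_trans ?_ (Finset.single_le_sum (f := fun j => Complex.normSq (S i j))
    (fun j _ => Complex.normSq_nonneg _) (Finset.mem_univ i))
  rw [Complex.normSq_apply]
  nlinarith [mul_self_nonneg (S i i).im]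

/-! ### Hermitian forms in a basis. -/

section Gram

variable {W : Type*} [AddCommGroup W] [Module ℂ W] {ι : Type*}

/-- The matrix of a sesquilinear form in a basis. -/
def SesqForm.gram (b : Module.Basis ι ℂ W) (v : SesqForm W) : Matrix ι ι ℂ :=
  Matrix.of fun i j => v (b i) (b j)

theorem SesqForm.IsHermitian.gram {v : SesqForm W} (hv : v.IsHermitian)
    (b : Module.Basis ι ℂ W) : (v.gram b).IsHermitian := by
  ext i j
  simp [SesqForm.gram, hv (b i) (b j)]

theorem SesqForm.IsHermitian.apply_self_im {v : SesqForm W} (hv : v.IsHermitian) (a : W) :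
    (v a a).im = 0 := Complex.conj_eq_iff_im.1 (hv a a).symm

variable [Fintype ι]

theorem SesqForm.IsPosDef.gram {h : SesqForm W} (hpos : h.IsPosDef) (hh : h.IsHermitian)
    (b : Module.Basis ι ℂ W) : (h.gram b).PosDef := by
  refine Matrix.PosDef.of_dotProduct_mulVec_pos (hh.gram b) fun x hx => ?_
  -- Coordinates are conjugated because the forms are linear in the first slot, where `star x ⬝ᵥ _`
  -- carries the conjugate.
  set a : W := ∑ i, conj (x i) • b i with ha
  have ha0 : a ≠ 0 := by
    intro h0
    apply hx
    have := Fintype.linearIndependent_iff.1 b.linearIndependent (fun i => conj (x i)) (by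
      rw [← ha, h0])
    funext i
    simpa using this i
  have key : star x ⬝ᵥ (h.gram b).mulVec x = h a a := by
    simp only [ha, map_sum, LinearMap.sum_apply, map_smulₛₗ, LinearMap.smul_apply, dotProduct,
      Matrix.mulVec, SesqForm.gram, Matrix.of_apply, Pi.star_apply, smul_eq_mul,
      Complex.conj_conj, RingHom.id_apply, Finset.mul_sum]
    rw [Finset.sum_comm]
    refine Finset.sum_congr rfl fun j _ => Finset.sum_congr rfl fun i _ => ?_
    simp only [Complex.star_def]
    ring
  rw [key, Complex.lt_def]
  exact ⟨hpos a ha0, (hh.apply_self_im a).symm⟩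

variable [DecidableEq ι]

/-- The conjugation comes from expanding `h (bᵢ, (h⁻¹v) bⱼ)` in its conjugate linear second slot. It
disappears from the real parts of traces, which are all that `innerAt` uses. -/
theorem SesqForm.toMatrix_invMul {h : SesqForm W} (hpos : h.IsPosDef) (hh : h.IsHermitian)
    (v : SesqForm W) (b : Module.Basis ι ℂ W) :
    (LinearMap.toMatrix b b (h.invMul v)).map conj = (h.gram b)⁻¹ * v.gram b := by
  have : FiniteDimensional ℂ W := b.finiteDimensional_of_finite
  have hu := (hpos.gram hh b).isUnit
  have key : h.gram b * (LinearMap.toMatrix b b (h.invMul v)).map conj = v.gram b := by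
    ext i j
    have h1 := SesqForm.apply_invMul hpos v (b i) (b j)
    rw [← b.sum_repr (h.invMul v (b j))] at h1
    simp only [map_sum, map_smulₛₗ, smul_eq_mul] at h1
    simp only [Matrix.mul_apply, SesqForm.gram, Matrix.of_apply, Matrix.map_apply,
      LinearMap.toMatrix_apply]
    rw [← h1]
    exact Finset.sum_congr rfl fun k _ => mul_comm _ _
  rw [← key, ← Matrix.mul_assoc, Matrix.nonsing_inv_mul _ ((Matrix.isUnit_iff_isUnit_det _).1 hu),
    Matrix.one_mul]

theorem SesqForm.trace_invMul_re {h : SesqForm W} (hpos : h.IsPosDef) (hh : h.IsHermitian)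
    (v : SesqForm W) (b : Module.Basis ι ℂ W) :
    (LinearMap.trace ℂ W (h.invMul v)).re = ((h.gram b)⁻¹ * v.gram b).trace.re := by
  rw [← SesqForm.toMatrix_invMul hpos hh, LinearMap.trace_eq_matrix_trace ℂ b]
  simp [Matrix.trace, Complex.re_sum]

theorem SesqForm.trace_invMul_mul_re {h : SesqForm W} (hpos : h.IsPosDef) (hh : h.IsHermitian)
    (v w : SesqForm W) (b : Module.Basis ι ℂ W) :
    (LinearMap.trace ℂ W (h.invMul v * h.invMul w)).re =
      ((h.gram b)⁻¹ * v.gram b * ((h.gram b)⁻¹ * w.gram b)).trace.re := by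
  rw [← SesqForm.toMatrix_invMul hpos hh, ← SesqForm.toMatrix_invMul hpos hh,
    LinearMap.trace_eq_matrix_trace ℂ b, LinearMap.toMatrix_mul, ← Matrix.map_mul]
  simp only [Matrix.trace, Complex.re_sum, Matrix.diag_apply, Matrix.map_apply, Complex.conj_re]

/-- The pointwise inner product dominates the part that comes from the trace. -/
theorem SesqForm.le_innerAt {h : SesqForm W} (hpos : h.IsPosDef) (hh : h.IsHermitian)
    {v : SesqForm W} (hv : v.IsHermitian) (α : ℝ) (b : Module.Basis ι ℂ W) [Nonempty ι] :
    (1 / Fintype.card ι + α) * (LinearMap.trace ℂ W (h.invMul v)).re ^ 2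
      ≤ SesqForm.innerAt α h v v := by
  have h1 := (hpos.gram hh b).trace_inv_mul_sq_le (hv.gram b)
  rw [SesqForm.innerAt, SesqForm.trace_invMul_re hpos hh v b,
    SesqForm.trace_invMul_mul_re hpos hh v v b]
  have hc : (0 : ℝ) < Fintype.card ι := by exact_mod_cast Fintype.card_pos
  have h2 : 1 / (Fintype.card ι : ℝ) * ((h.gram b)⁻¹ * v.gram b).trace.re ^ 2
      ≤ ((h.gram b)⁻¹ * v.gram b * ((h.gram b)⁻¹ * v.gram b)).trace.re := by
    rw [one_div, inv_mul_le_iff₀ hc]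
    exact h1
  nlinarith

/-- Along a conformal direction the operator `h⁻¹v` is scalar. -/
theorem SesqForm.invMul_smul_self {h : SesqForm W} [FiniteDimensional ℂ W] (hpos : h.IsPosDef)
    (c : ℝ) {k : ℝ} (hk : 0 < k) :
    SesqForm.invMul (k • h) ((c * k) • h) = (c : ℂ) • (1 : Module.End ℂ W) := by
  have hpos' : SesqForm.IsPosDef (k • h) := fun a ha => by
    have h1 := mul_pos hk (hpos a ha)
    rwa [← Complex.re_ofReal_mul, ← Complex.real_smul] at h1
  ext b
  -- Nondegeneracy lets the identity of endomorphisms be tested inside the form.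
  have hz : ∀ z, (∀ a, (k • h) a z = 0) → z = 0 := by
    intro z hz
    by_contra hne
    have := hpos' z hne
    rw [hz z] at this
    simp at this
  rw [← sub_eq_zero]
  refine hz _ fun a => ?_
  rw [map_sub, SesqForm.apply_invMul hpos']
  simp only [LinearMap.smul_apply, Complex.real_smul, Module.End.one_apply, map_smulₛₗ,
    smul_eq_mul, Complex.conj_ofReal]
  push_cast
  ring

end Gram

end

/-! ### Finiteness of the Riemannian volume -/

section VolumeFinite

variable {n : ℕ} {M : Type*} [TopologicalSpace M] [ChartedSpace (EuclideanSpace ℝ (Fin n)) M]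
  [IsManifold (𝓡 n) ∞ M]

/-- The trivialization of the tangent bundle at `p` is the derivative of the chart, so coordinate
fields are constant in it. Their continuity as sections follows. -/
theorem coordVector_eq (p : M) {u : EuclideanSpace ℝ (Fin n)}
    (hu : u ∈ (chartAt (EuclideanSpace ℝ (Fin n)) p).target) (i : Fin n) :
    coordVector p u i =
      (trivializationAt (EuclideanSpace ℝ (Fin n)) (TangentSpace (𝓡 n)) p).symm
        ((chartAt (EuclideanSpace ℝ (Fin n)) p).symm u) (EuclideanSpace.single i (1 : ℝ)) := by
  have h1 := TangentBundle.symmL_trivializationAt (I := 𝓡 n) (x₀ := p)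
    ((chartAt (EuclideanSpace ℝ (Fin n)) p).map_target hu)
  have h2 := DFunLike.congr_fun h1 (EuclideanSpace.single i (1 : ℝ))
  rw [Bundle.Trivialization.symmL_apply] at h2
  · rw [h2]
    simp only [coordVector, mfld_simps, mfderivWithin_univ]
    exact (congrArg (fun w => (mfderiv 𝓘(ℝ, EuclideanSpace ℝ (Fin n)) (𝓡 n)
      (chartAt (EuclideanSpace ℝ (Fin n)) p).symm w : EuclideanSpace ℝ (Fin n) →L[ℝ]
        EuclideanSpace ℝ (Fin n)) (EuclideanSpace.single i (1 : ℝ)))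
      ((chartAt (EuclideanSpace ℝ (Fin n)) p).right_inv hu)).symm
  · exact (chartAt (EuclideanSpace ℝ (Fin n)) p).map_target hu

theorem continuousOn_chartDensity (g : SmoothRiemannianMetric n M) (p : M) :
    ContinuousOn (chartDensity g p) (chartAt (EuclideanSpace ℝ (Fin n)) p).target := by
  set c := chartAt (EuclideanSpace ℝ (Fin n)) p with hc
  have hv : ∀ i : Fin n, ContinuousOn (fun u => TotalSpace.mk' (EuclideanSpace ℝ (Fin n))
      (E := fun x : M => TangentSpace (𝓡 n) x) (c.symm u) (coordVector p u i)) c.target := by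
    intro i
    have h1 := (trivializationAt (EuclideanSpace ℝ (Fin n))
      (fun x : M => TangentSpace (𝓡 n) x) p).continuousOn_symm
    have h2 : ContinuousOn (fun u => (c.symm u, EuclideanSpace.single i (1 : ℝ))) c.target :=
      c.continuousOn_symm.prodMk continuousOn_const
    refine (h1.comp h2 fun u hu => ?_).congr fun u hu => ?_
    · refine ⟨?_, mem_univ _⟩
      exact c.map_target hu
    · simp only [Function.comp_apply]
      rw [coordVector_eq p hu i]
  have hg : ContinuousOn (fun u => TotalSpace.mk'
      (EuclideanSpace ℝ (Fin n) →L[ℝ] EuclideanSpace ℝ (Fin n) →L[ℝ] ℝ)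
      (E := fun x : M => TangentSpace (𝓡 n) x →L[ℝ] TangentSpace (𝓡 n) x →L[ℝ] ℝ)
      (c.symm u) (g.inner (c.symm u))) c.target :=
    g.contMDiff.continuous.comp_continuousOn c.continuousOn_symm
  have hij : ∀ i j : Fin n, ContinuousOn (fun u => g.inner (c.symm u) (coordVector p u i)
      (coordVector p u j)) c.target := by
    intro i j
    have h1 := ContinuousOn.clm_bundle_apply₂ (F₁ := EuclideanSpace ℝ (Fin n))
      (F₂ := EuclideanSpace ℝ (Fin n)) (F₃ := ℝ) (E₁ := fun x : M => TangentSpace (𝓡 n) x)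
      (E₂ := fun x : M => TangentSpace (𝓡 n) x) (E₃ := Bundle.Trivial M ℝ) hg (hv i) (hv j)
    have h2 := (Bundle.Trivial.homeomorphProd M ℝ).continuous.comp_continuousOn h1
    exact continuous_snd.comp_continuousOn h2
  intro u hu
  refine ContinuousWithinAt.sqrt ?_
  have h3 : ContinuousOn (fun u => Matrix.of fun i j : Fin n =>
      g.inner (c.symm u) (coordVector p u i) (coordVector p u j)) c.target :=
    continuousOn_pi.2 fun i => continuousOn_pi.2 fun j => hij i j
  exact (continuous_id.matrix_det.comp_continuousOn h3) u hu

variable [MeasurableSpace M]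

/-- A set inside a chart domain covers itself, and the chart at `p` competes in the infimum. This
one-sided bound suffices for finiteness, so chart volumes need not be compared. -/
theorem riemannianVolume_le_chartVolume (g : SmoothRiemannianMetric n M) (p : M) {A : Set M}
    (hA : MeasurableSet A) (hAp : A ⊆ (chartAt (EuclideanSpace ℝ (Fin n)) p).source) :
    riemannianVolume g A ≤ chartVolume g p A := by
  rw [riemannianVolume, toMeasure_apply _ _ hA]
  exact (OuterMeasure.boundedBy_le A).trans (iInf₂_le p hAp)

variable [BorelSpace M]

/-- The density is bounded on a compact coordinate neighbourhood, which has finite Lebesgue measure.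
-/
theorem exists_nhds_riemannianVolume_lt_top (g : SmoothRiemannianMetric n M) (p : M) :
    ∃ A ∈ 𝓝 p, riemannianVolume g A < ⊤ := by
  set c := chartAt (EuclideanSpace ℝ (Fin n)) p with hc
  have hp : c p ∈ c.target := c.map_source (mem_chart_source _ p)
  obtain ⟨K, hK, hpK, hKt⟩ := exists_compact_subset c.open_target hp
  have hopen : IsOpen (c.symm '' interior K) :=
    c.symm.isOpen_image_of_subset_source isOpen_interior (interior_subset.trans hKt)
  have hsub : c.symm '' interior K ⊆ c.source := by
    rintro _ ⟨u, hu, rfl⟩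
    exact c.map_target (hKt (interior_subset hu))
  refine ⟨c.symm '' interior K, hopen.mem_nhds ⟨c p, hpK, c.left_inv (mem_chart_source _ p)⟩, ?_⟩
  refine (riemannianVolume_le_chartVolume g p hopen.measurableSet hsub).trans_lt ?_
  have hmeas : AEMeasurable c.symm
      ((volume.restrict c.target).withDensity fun u => ENNReal.ofReal (chartDensity g p u)) :=
    (c.continuousOn_symm.aemeasurable c.open_target.measurableSet).mono_ac
      (withDensity_absolutelyContinuous _ _)
  rw [chartVolume, Measure.map_apply_of_aemeasurable hmeas hopen.measurableSet]
  have hnull : MeasurableSet (c.symm ⁻¹' (c.symm '' interior K) ∩ c.target) := by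
    rw [inter_comm]
    exact (c.continuousOn_symm.isOpen_inter_preimage c.open_target hopen).measurableSet
  have hinter : c.symm ⁻¹' (c.symm '' interior K) ∩ c.target ⊆ K := by
    rintro u ⟨⟨w, hw, hwu⟩, hu⟩
    have := c.symm.injOn (hKt (interior_subset hw)) hu hwu
    exact this ▸ interior_subset hw
  -- Off its target `c.symm` has arbitrary values, so the preimage may contain stray points; they
  -- form a null set.
  have hcompl : ((volume.restrict c.target).withDensity
      fun u => ENNReal.ofReal (chartDensity g p u)) c.targetᶜ = 0 := by
    refine withDensity_absolutelyContinuous _ _ ?_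
    rw [Measure.restrict_apply c.open_target.measurableSet.compl, compl_inter_self, measure_empty]
  refine (measure_mono (t := (c.symm ⁻¹' (c.symm '' interior K) ∩ c.target) ∪ c.targetᶜ)
    fun u hu => ?_).trans_lt ?_
  · by_cases h : u ∈ c.target
    · exact Or.inl ⟨hu, h⟩
    · exact Or.inr h
  refine (measure_union_le _ _).trans_lt ?_
  rw [hcompl, add_zero, withDensity_apply _ hnull]
  obtain ⟨C, hC⟩ := hK.exists_bound_of_continuousOn ((continuousOn_chartDensity g p).mono hKt)
  calc ∫⁻ u in c.symm ⁻¹' (c.symm '' interior K) ∩ c.target, ENNReal.ofReal (chartDensity g p u)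
        ∂volume.restrict c.target
      ≤ ∫⁻ _ in c.symm ⁻¹' (c.symm '' interior K) ∩ c.target, ENNReal.ofReal C
        ∂volume.restrict c.target :=
        setLIntegral_mono measurable_const fun u hu =>
          ENNReal.ofReal_le_ofReal ((le_abs_self _).trans (hC u (hinter hu)))
    _ ≤ ENNReal.ofReal C * volume K := by
        rw [setLIntegral_const]
        exact mul_le_mul' le_rfl ((Measure.restrict_apply_le _ _).trans (measure_mono hinter))
    _ < ⊤ := ENNReal.mul_lt_top ENNReal.ofReal_lt_top hK.measure_lt_top

instance isFiniteMeasure_riemannianVolume [CompactSpace M] (g : SmoothRiemannianMetric n M) :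
    IsFiniteMeasure (riemannianVolume g) := by
  refine ⟨isCompact_univ.measure_lt_top_of_nhdsWithin fun p _ => ?_⟩
  obtain ⟨A, hA, hA'⟩ := exists_nhds_riemannianVolume_lt_top g p
  exact ⟨A, mem_nhdsWithin_of_mem_nhds hA, hA'⟩

end VolumeFinite

theorem Matrix.continuousWithinAt_inv_mul {ι X : Type*} [Fintype ι] [DecidableEq ι]
    [TopologicalSpace X] {D : Set X} {p : X} {A B : X → Matrix ι ι ℂ} (hdet : (A p).det ≠ 0)
    (hA : ∀ i j, ContinuousWithinAt (fun q => A q i j) D p)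
    (hB : ∀ i j, ContinuousWithinAt (fun q => B q i j) D p) :
    ContinuousWithinAt (fun q => (A q)⁻¹ * B q) D p := by
  have hA' : ContinuousWithinAt A D p :=
    continuousWithinAt_pi.2 fun i => continuousWithinAt_pi.2 fun j => hA i j
  have hB' : ContinuousWithinAt B D p :=
    continuousWithinAt_pi.2 fun i => continuousWithinAt_pi.2 fun j => hB i j
  have h0 : ContinuousAt Ring.inverse (A p).det := by
    simpa using NormedRing.inverse_continuousAt hdet.isUnit.unit
  have h2 : ContinuousWithinAt (fun q => (A q)⁻¹) D p :=
    ContinuousAt.comp_continuousWithinAt (g := fun m : Matrix ι ι ℂ => m⁻¹)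
      (continuousAt_matrix_inv _ h0) hA'
  exact ContinuousWithinAt.mul (M := Matrix ι ι ℂ) h2 hB'

/-! ### Continuity of the evaluation of sections -/

section Evaluation

set_option linter.unusedSectionVars false

variable {n r : ℕ} {M : Type*} [TopologicalSpace M] [ChartedSpace (EuclideanSpace ℝ (Fin n)) M]
  {V : M → Type*} [TopologicalSpace (TotalSpace (EuclideanSpace ℂ (Fin r)) V)]
  [∀ x, TopologicalSpace (V x)] [∀ x, AddCommGroup (V x)] [∀ x, Module ℂ (V x)]
  [FiberBundle (EuclideanSpace ℂ (Fin r)) V] [VectorBundle ℂ (EuclideanSpace ℂ (Fin r)) V]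

theorem isOpen_coordDomain
    (e : Trivialization (EuclideanSpace ℂ (Fin r)) (π (EuclideanSpace ℂ (Fin r)) V)) (p : M) :
    IsOpen (coordDomain n e p) :=
  (chartAt (EuclideanSpace ℝ (Fin n)) p).isOpen_inter_preimage_symm e.open_baseSet

/-- The evaluation `(s, x) ↦ s x` is continuous in every local frame. -/
theorem continuousOn_localEntry_eval
    {e : Trivialization (EuclideanSpace ℂ (Fin r)) (π (EuclideanSpace ℂ (Fin r)) V)}
    (he : e ∈ FiberBundle.trivializationAtlas (EuclideanSpace ℂ (Fin r)) V) (i j : Fin r) :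
    ContinuousOn (fun p : HermSection n r V × M => localEntry e i j p.1.1 p.2)
      (univ ×ˢ e.baseSet) := by
  rintro ⟨s, x⟩ ⟨-, hx⟩
  refine ContinuousAt.continuousWithinAt ?_
  set c := chartAt (EuclideanSpace ℝ (Fin n)) x with hc
  set 𝔖 : Set (Set (EuclideanSpace ℝ (Fin n))) := {K | IsCompact K ∧ K ⊆ coordDomain n e x}
    with h𝔖
  have hxs : x ∈ c.source := mem_chart_source _ x
  have hcx : c x ∈ coordDomain n e x :=
    ⟨c.map_source hxs, by simpa only [mem_preimage, ← hc, c.left_inv hxs] using hx⟩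
  set Φ : HermSection n r V → UniformOnFun (EuclideanSpace ℝ (Fin n)) _ 𝔖 := fun s =>
    UniformOnFun.ofFun 𝔖 (iteratedFDeriv ℝ 0 fun u : EuclideanSpace ℝ (Fin n) =>
      localEntry e i j s.1 (c.symm u)) with hΦ
  have hΦc : Continuous Φ :=
    continuous_iInf_dom (i := ⟨e, he⟩) <| continuous_iInf_dom (i := x) <|
      continuous_iInf_dom (i := i) <| continuous_iInf_dom (i := j) <|
      continuous_iInf_dom (i := 0) continuous_induced_dom
  have hentry : ∀ (s : HermSection n r V) (u : EuclideanSpace ℝ (Fin n)),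
      UniformOnFun.toFun 𝔖 (Φ s) u 0 = localEntry e i j s.1 (c.symm u) := by
    intro s u
    simp only [hΦ, UniformOnFun.toFun_ofFun]
    exact iteratedFDeriv_zero_apply _
  have hs : ContinuousAt (UniformOnFun.toFun 𝔖 (Φ s)) (c x) := by
    simp only [hΦ, UniformOnFun.toFun_ofFun]
    have h1 : ContinuousAt (fun u => localEntry e i j s.1 (c.symm u)) (c x) := by
      have h2 : ContinuousAt (localEntry e i j s.1) x :=
        (s.2.2 e he i j).continuousOn.continuousAt (e.open_baseSet.mem_nhds hx)
      have h8 : ContinuousAt (localEntry e i j s.1) (c.symm (c x)) := by rwa [c.left_inv hxs]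
      exact h8.comp (c.continuousAt_symm (c.map_source hxs))
    rw [iteratedFDeriv_zero_eq_comp]
    have h7 : Continuous (continuousMultilinearCurryFin0 ℝ (EuclideanSpace ℝ (Fin n)) ℂ).symm :=
      LinearIsometryEquiv.continuous _
    exact h7.continuousAt.comp h1
  -- Uniform convergence on one compact neighbourhood of `c x`, together with continuity of the
  -- limit there, gives joint continuity of evaluation.
  obtain ⟨K, hK, hxK, hKU⟩ := exists_compact_subset (isOpen_coordDomain e x) hcx
  have h3 := UniformOnFun.continuousAt_eval₂ (𝔖 := 𝔖) (f := Φ s) (x := c x)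
    ⟨K, ⟨hK, hKU⟩, mem_interior_iff_mem_nhds.1 hxK⟩ hs
  have h4 : ContinuousAt (fun p : HermSection n r V × M => (Φ p.1, c p.2)) (s, x) :=
    (hΦc.continuousAt.comp continuousAt_fst).prodMk
      ((c.continuousAt hxs).comp continuousAt_snd)
  have h6 : ContinuousAt (fun p : HermSection n r V × M =>
      UniformOnFun.toFun 𝔖 (Φ p.1) (c p.2)) (s, x) :=
    ContinuousAt.comp (x := (s, x)) (f := fun p : HermSection n r V × M => (Φ p.1, c p.2)) h3 h4
  have h5 : ContinuousAt (fun p : HermSection n r V × M =>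
      UniformOnFun.toFun 𝔖 (Φ p.1) (c p.2) 0) (s, x) :=
    (ContinuousMultilinearMap.apply ℝ (fun _ : Fin 0 => EuclideanSpace ℝ (Fin n)) ℂ
      0).continuous.continuousAt.comp h6
  refine h5.congr ?_
  filter_upwards [continuousAt_snd.preimage_mem_nhds (c.open_source.mem_nhds hxs)] with p hp
  rw [hentry, c.left_inv hp]

/-- The linear functional `s ↦ s_{ij}(x)`. -/
def localEntryₗ
    (e : Trivialization (EuclideanSpace ℂ (Fin r)) (π (EuclideanSpace ℂ (Fin r)) V))
    (i j : Fin r) (x : M) : HermSection n r V →ₗ[ℝ] ℂ where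
  toFun s := localEntry e i j s.1 x
  map_add' s t := by simp [localEntry]
  map_smul' c s := by simp [localEntry]

/-- The local frame of the bundle that is given by a trivialization. -/
def localFrame (e : Trivialization (EuclideanSpace ℂ (Fin r)) (π (EuclideanSpace ℂ (Fin r)) V))
    [e.IsLinear ℂ] {x : M} (hx : x ∈ e.baseSet) : Module.Basis (Fin r) ℂ (V x) :=
  (EuclideanSpace.basisFun (Fin r) ℂ).toBasis.map (e.linearEquivAt ℂ x hx).symm

theorem gram_localFrame
    (e : Trivialization (EuclideanSpace ℂ (Fin r)) (π (EuclideanSpace ℂ (Fin r)) V))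
    [e.IsLinear ℂ] {x : M} (hx : x ∈ e.baseSet) (s : ∀ x, SesqForm (V x)) :
    (s x).gram (localFrame e hx) = Matrix.of fun i j => localEntry e i j s x := by
  ext i j
  simp [SesqForm.gram, localFrame, localEntry]

theorem IsC1On.hasDerivWithinAt_localEntry {γ v : ℝ → HermSection n r V} {a b : ℝ}
    (hγ : IsC1On γ v a b)
    {e : Trivialization (EuclideanSpace ℂ (Fin r)) (π (EuclideanSpace ℂ (Fin r)) V)}
    (he : e ∈ FiberBundle.trivializationAtlas (EuclideanSpace ℂ (Fin r)) V) (i j : Fin r)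
    {x : M} (hx : x ∈ e.baseSet) {t : ℝ} (ht : t ∈ Icc a b) :
    HasDerivWithinAt (fun τ => localEntry e i j (γ τ).1 x) (localEntry e i j (v t).1 x)
      (Icc a b) t := by
  rw [hasDerivWithinAt_iff_tendsto_slope]
  have hcont : Continuous (fun s : HermSection n r V => localEntry e i j s.1 x) :=
    (continuousOn_localEntry_eval (n := n) he i j).comp_continuous
      (continuous_id.prodMk continuous_const) fun s => ⟨mem_univ _, hx⟩
  refine ((hcont.tendsto (v t)).comp (hγ.tendsto_slope t ht)).congr fun s => ?_
  have := (localEntryₗ (n := n) e i j x).map_smul (s - t)⁻¹ (γ s - γ t)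
  exact this.trans (congrArg ((s - t)⁻¹ • ·) (map_sub (localEntryₗ (n := n) e i j x) (γ s) (γ t)))

/-- Continuity of `γ` is not part of `IsC1On`. It is recovered from `γ s = γ t + (s - t) q s`, where
`q` is the slope filled in by `v t` at `t`. The identity is used entrywise, so continuity of the
vector space operations on sections is never invoked. -/
theorem IsC1On.continuousOn_localEntry {γ v : ℝ → HermSection n r V} {a b : ℝ}
    (hγ : IsC1On γ v a b)
    {e : Trivialization (EuclideanSpace ℂ (Fin r)) (π (EuclideanSpace ℂ (Fin r)) V)}
    (he : e ∈ FiberBundle.trivializationAtlas (EuclideanSpace ℂ (Fin r)) V) (i j : Fin r) :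
    ContinuousOn (fun p : ℝ × M => localEntry e i j (γ p.1).1 p.2) (Icc a b ×ˢ e.baseSet) := by
  rintro ⟨t, x⟩ ⟨ht, hx⟩
  set q : ℝ → HermSection n r V := Function.update (slope γ t) t (v t) with hq
  have hqc : ContinuousWithinAt q (Icc a b) t :=
    continuousWithinAt_update_same.2 (hγ.tendsto_slope t ht)
  have heq : ∀ s y, localEntry e i j (γ s).1 y =
      localEntry e i j (γ t).1 y + (s - t) • localEntry e i j (q s).1 y := by
    intro s y
    have h1 : γ s = γ t + (s - t) • q s := by
      rcases eq_or_ne s t with rfl | hst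
      · simp
      · rw [hq, Function.update_of_ne hst, sub_smul_slope]
        simp
    have h2 : localEntryₗ (n := n) e i j y (γ s) = localEntryₗ (n := n) e i j y (γ t) +
        (s - t) • localEntryₗ (n := n) e i j y (q s) := by
      rw [← map_smul, ← map_add, ← h1]
    exact h2
  have hev := continuousOn_localEntry_eval (n := n) (V := V) he i j
  have h1 : ContinuousWithinAt (fun p : ℝ × M => localEntry e i j (γ t).1 p.2)
      (Icc a b ×ˢ e.baseSet) (t, x) :=
    ContinuousWithinAt.comp (x := (t, x)) (hev (γ t, x) ⟨mem_univ _, hx⟩) (f := fun p : ℝ × M => (γ t, p.2))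
      (continuousWithinAt_const.prodMk continuousWithinAt_snd) fun p hp => ⟨mem_univ _, hp.2⟩
  have h2 : ContinuousWithinAt (fun p : ℝ × M => localEntry e i j (q p.1).1 p.2)
      (Icc a b ×ˢ e.baseSet) (t, x) :=
    ContinuousWithinAt.comp (x := (t, x)) (hev (q t, x) ⟨mem_univ _, hx⟩) (f := fun p : ℝ × M => (q p.1, p.2))
      ((ContinuousWithinAt.comp (x := (t, x)) hqc (f := fun p : ℝ × M => p.1) continuousWithinAt_fst fun p hp => hp.1).prodMk
        continuousWithinAt_snd) fun p hp => ⟨mem_univ _, hp.2⟩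
  have h3 : ContinuousWithinAt (fun p : ℝ × M => p.1 - t) (Icc a b ×ˢ e.baseSet) (t, x) :=
    (continuous_fst.sub continuous_const).continuousWithinAt
  exact (h1.add (h3.smul h2)).congr (fun p _ => heq _ _) (heq _ _)

theorem IsC1On.continuousOn_velocity_localEntry {γ v : ℝ → HermSection n r V} {a b : ℝ}
    (hγ : IsC1On γ v a b)
    {e : Trivialization (EuclideanSpace ℂ (Fin r)) (π (EuclideanSpace ℂ (Fin r)) V)}
    (he : e ∈ FiberBundle.trivializationAtlas (EuclideanSpace ℂ (Fin r)) V) (i j : Fin r) :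
    ContinuousOn (fun p : ℝ × M => localEntry e i j (v p.1).1 p.2) (Icc a b ×ˢ e.baseSet) :=
  (continuousOn_localEntry_eval (n := n) he i j).comp
    ((hγ.continuousOn.comp continuousOn_fst fun _ hp => hp.1).prodMk continuousOn_snd)
    fun _ hp => ⟨mem_univ _, hp.2⟩

/-! ### Joint continuity in time and space, and the logarithm of the determinant. -/

section JointContinuity

variable {γ v : ℝ → HermSection n r V} {a b : ℝ}

open scoped ComplexOrder in
theorem posDef_matrix_localEntry {s : HermSection n r V} {x : M} (hs : (s.1 x).IsPosDef)
    {e : Trivialization (EuclideanSpace ℂ (Fin r)) (π (EuclideanSpace ℂ (Fin r)) V)}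
    [e.IsLinear ℂ] (hx : x ∈ e.baseSet) :
    (Matrix.of fun i j => localEntry e i j s.1 x).PosDef := by
  rw [← gram_localFrame e hx]
  exact hs.gram (s.2.1 x) _

/-- Continuity is local, so near `x` the trivialization at `x` may be used even though `F` is
defined without a frame. The trace and the squared norm are both instances. -/
theorem IsC1On.continuousOn_of_matrix (hγ : IsC1On γ v a b)
    (hpos : ∀ t ∈ Icc a b, ∀ x, ((γ t).1 x).IsPosDef) {F : ℝ × M → ℝ}
    {Ψ : Matrix (Fin r) (Fin r) ℂ → ℝ} (hΨ : Continuous Ψ)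
    (hF : ∀ t ∈ Icc a b, ∀ (x : M)
      (e : Trivialization (EuclideanSpace ℂ (Fin r)) (π (EuclideanSpace ℂ (Fin r)) V))
      [e.IsLinear ℂ] (hx : x ∈ e.baseSet),
      F (t, x) = Ψ ((((γ t).1 x).gram (localFrame e hx))⁻¹ *
        ((v t).1 x).gram (localFrame e hx))) :
    ContinuousOn F (Icc a b ×ˢ univ) := by
  rintro ⟨t, x⟩ ⟨ht, -⟩
  set e := trivializationAt (EuclideanSpace ℂ (Fin r)) V x with he
  have hmem : e ∈ FiberBundle.trivializationAtlas (EuclideanSpace ℂ (Fin r)) V :=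
    FiberBundle.trivialization_mem_atlas' x
  have hxe : x ∈ e.baseSet := FiberBundle.mem_baseSet_trivializationAt' x
  have hnhds : (univ ×ˢ e.baseSet : Set (ℝ × M)) ∈ 𝓝 (t, x) :=
    prod_mem_nhds univ_mem (e.open_baseSet.mem_nhds hxe)
  rw [← continuousWithinAt_inter hnhds]
  have hset : (Icc a b ×ˢ univ ∩ univ ×ˢ e.baseSet : Set (ℝ × M)) = Icc a b ×ˢ e.baseSet := by
    ext ⟨_, _⟩; simp
  rw [hset]
  have hcong : ∀ q ∈ (Icc a b ×ˢ e.baseSet : Set (ℝ × M)), F q =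
      Ψ ((Matrix.of fun i j => localEntry e i j (γ q.1).1 q.2)⁻¹ *
        Matrix.of fun i j => localEntry e i j (v q.1).1 q.2) := by
    rintro ⟨s, y⟩ ⟨hs, hy⟩
    rw [hF s hs y e hy, gram_localFrame, gram_localFrame]
  refine ContinuousWithinAt.congr ?_ hcong (hcong _ ⟨ht, hxe⟩)
  refine hΨ.continuousAt.comp_continuousWithinAt (Matrix.continuousWithinAt_inv_mul ?_
    (fun i j => hγ.continuousOn_localEntry hmem i j _ ⟨ht, hxe⟩)
    (fun i j => hγ.continuousOn_velocity_localEntry hmem i j _ ⟨ht, hxe⟩))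
  intro h0
  have h1 := (posDef_matrix_localEntry (hpos t ht x) hxe).det_re_pos
  rw [h0] at h1
  exact lt_irrefl _ h1

theorem IsC1On.continuousOn_trace (hγ : IsC1On γ v a b)
    (hpos : ∀ t ∈ Icc a b, ∀ x, ((γ t).1 x).IsPosDef) :
    ContinuousOn (fun p : ℝ × M => (LinearMap.trace ℂ (V p.2)
      (((γ p.1).1 p.2).invMul ((v p.1).1 p.2))).re) (Icc a b ×ˢ univ) := by
  refine hγ.continuousOn_of_matrix hpos (Ψ := fun A => A.trace.re)
    (Complex.continuous_re.comp continuous_id.matrix_trace) fun t ht x e _ hx => ?_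
  exact SesqForm.trace_invMul_re (hpos t ht x) ((γ t).2.1 x) _ _

theorem IsC1On.continuousOn_innerAt (hγ : IsC1On γ v a b)
    (hpos : ∀ t ∈ Icc a b, ∀ x, ((γ t).1 x).IsPosDef) (α : ℝ) :
    ContinuousOn (fun p : ℝ × M => SesqForm.innerAt α ((γ p.1).1 p.2) ((v p.1).1 p.2)
      ((v p.1).1 p.2)) (Icc a b ×ˢ univ) := by
  have hc : Continuous fun A : Matrix (Fin r) (Fin r) ℂ => A.trace.re :=
    Complex.continuous_re.comp continuous_id.matrix_trace
  refine hγ.continuousOn_of_matrix hpos (Ψ := fun A => (A * A).trace.re +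
    α * (A.trace.re * A.trace.re))
    ((hc.comp (continuous_id.matrix_mul continuous_id)).add
      (continuous_const.mul (hc.mul hc))) fun t ht x e _ hx => ?_
  rw [SesqForm.innerAt, SesqForm.trace_invMul_mul_re (hpos t ht x) ((γ t).2.1 x) _ _
    (localFrame e hx), SesqForm.trace_invMul_re (hpos t ht x) ((γ t).2.1 x) _ (localFrame e hx)]

/-- The logarithm of the determinant of a metric at `x`, in the preferred local frame at `x`. -/
def logDet (s : HermSection n r V) (x : M) : ℝ :=
  Real.log (Matrix.det (Matrix.of fun i j =>
    localEntry (trivializationAt (EuclideanSpace ℂ (Fin r)) V x) i j s.1 x)).re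

theorem IsC1On.hasDerivWithinAt_logDet (hγ : IsC1On γ v a b)
    (hpos : ∀ t ∈ Icc a b, ∀ x, ((γ t).1 x).IsPosDef) (x : M) {t : ℝ} (ht : t ∈ Icc a b) :
    HasDerivWithinAt (fun τ => logDet (γ τ) x)
      (LinearMap.trace ℂ (V x) (((γ t).1 x).invMul ((v t).1 x))).re (Icc a b) t := by
  have hxe := FiberBundle.mem_baseSet_trivializationAt' (F := EuclideanSpace ℂ (Fin r)) (E := V) x
  have hmem := FiberBundle.trivialization_mem_atlas' (F := EuclideanSpace ℂ (Fin r)) (E := V) x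
  rw [SesqForm.trace_invMul_re (hpos t ht x) ((γ t).2.1 x) _ (localFrame _ hxe),
    gram_localFrame, gram_localFrame]
  exact Matrix.hasDerivWithinAt_log_re_det (posDef_matrix_localEntry (hpos t ht x) hxe)
    fun i j => hγ.hasDerivWithinAt_localEntry hmem i j hxe ht

/-- A conformal factor `e^f` multiplies an `r × r` determinant by `e^{r f}`. -/
theorem logDet_expMul [IsManifold (𝓡 n) ∞ M] (h : HermMetric n r V)
    (f : C^∞⟮𝓡 n, M; 𝓘(ℝ, ℝ), ℝ⟯) (x : M) :
    logDet (h.expMul f).form x = r * f x + logDet h.form x := by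
  have hxe := FiberBundle.mem_baseSet_trivializationAt' (F := EuclideanSpace ℂ (Fin r)) (E := V) x
  have h1 : (Matrix.of fun i j => localEntry (trivializationAt (EuclideanSpace ℂ (Fin r)) V x) i j
      (h.expMul f).form.1 x) = ((Real.exp (f x) : ℝ) : ℂ) • Matrix.of fun i j =>
      localEntry (trivializationAt (EuclideanSpace ℂ (Fin r)) V x) i j h.form.1 x := by
    ext i j
    simp [HermMetric.expMul, localEntry]
  have h2 := (posDef_matrix_localEntry (h.isPosDef x) hxe).det_re_pos
  rw [logDet, h1, Matrix.det_smul, Fintype.card_fin, ← Complex.ofReal_pow, Complex.re_ofReal_mul,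
    Real.log_mul (by positivity) h2.ne', Real.log_pow, Real.log_exp, logDet]

end JointContinuity

end Evaluation

/-! ### Lower bound for the length of paths -/

theorem MeasureTheory.integral_mul_le_sqrt_mul_sqrt {Ω : Type*} [MeasurableSpace Ω] {μ : Measure Ω}
    {f g : Ω → ℝ} (hf : Integrable (fun x => f x ^ 2) μ) (hg : Integrable (fun x => g x ^ 2) μ)
    (hfg : Integrable (fun x => f x * g x) μ) :
    ∫ x, f x * g x ∂μ ≤ √(∫ x, f x ^ 2 ∂μ) * √(∫ x, g x ^ 2 ∂μ) := by
  -- The quadratic `s ↦ ∫ (s f - g)²` is nonnegative, so its discriminant is not positive.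
  have h1 : ∀ s : ℝ, 0 ≤ (∫ x, f x ^ 2 ∂μ) * (s * s) + (-2 * ∫ x, f x * g x ∂μ) * s +
      ∫ x, g x ^ 2 ∂μ := by
    intro s
    have h2 : 0 ≤ ∫ x, (s * f x - g x) ^ 2 ∂μ := integral_nonneg fun x => sq_nonneg _
    have h3 : ∫ x, (s * f x - g x) ^ 2 ∂μ =
        ∫ x, ((s * s) * f x ^ 2 + (-2 * s) * (f x * g x)) + g x ^ 2 ∂μ := by
      congr 1 with x; ring
    have h5 := integral_add (μ := μ) (f := fun x => (s * s) * f x ^ 2 + (-2 * s) * (f x * g x))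
      ((hf.const_mul _).add (hfg.const_mul _)) hg
    have h6 := integral_add (μ := μ) (hf.const_mul (s * s)) (hfg.const_mul (-2 * s))
    rw [h3, h5, h6, integral_const_mul, integral_const_mul] at h2
    linarith
  have h4 := discrim_le_zero h1
  rw [discrim] at h4
  rw [← Real.sqrt_mul (integral_nonneg fun x => sq_nonneg _)]
  exact Real.le_sqrt_of_sq_le (by nlinarith)

/-- Fubini's theorem and the Cauchy–Schwarz inequality for a continuous family of functions on a
compact space. -/
theorem integral_mul_intervalIntegral_le {M : Type*} [TopologicalSpace M] [CompactSpace M]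
    [T2Space M] [SecondCountableTopology M] [MeasurableSpace M] [BorelSpace M] {μ : Measure M}
    [IsFiniteMeasure μ] {a b : ℝ} (hab : a ≤ b) {T : ℝ × M → ℝ}
    (hT : ContinuousOn T (Icc a b ×ˢ univ)) {φ : M → ℝ} (hφ : Continuous φ) :
    Integrable (fun x => φ x * ∫ t in a..b, T (t, x)) μ ∧
      ∫ x, φ x * (∫ t in a..b, T (t, x)) ∂μ ≤
        √(∫ x, φ x ^ 2 ∂μ) * ∫ t in a..b, √(∫ x, T (t, x) ^ 2 ∂μ) := by
  have hcont : ∀ t ∈ Icc a b, Continuous fun x => T (t, x) := fun t ht =>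
    hT.comp_continuous (by fun_prop) fun x => ⟨ht, mem_univ _⟩
  have hint : ∀ {ψ : M → ℝ}, Continuous ψ → Integrable ψ μ := fun h =>
    integrableOn_univ.1 (h.continuousOn.integrableOn_compact isCompact_univ)
  have hφT : ContinuousOn (fun p : ℝ × M => φ p.2 * T p) (Icc a b ×ˢ univ) :=
    (hφ.comp continuous_snd).continuousOn.mul hT
  have hprod : Integrable (Function.uncurry fun (t : ℝ) (x : M) => φ x * T (t, x))
      ((volume.restrict (uIoc a b)).prod μ) := by
    have h1 : IntegrableOn (fun p : ℝ × M => φ p.2 * T p) (Icc a b ×ˢ univ) (volume.prod μ) :=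
      hφT.integrableOn_compact (isCompact_Icc.prod isCompact_univ)
    have h2 : IntegrableOn (fun p : ℝ × M => φ p.2 * T p) (uIoc a b ×ˢ univ) (volume.prod μ) := by
      rw [uIoc_of_le hab]
      exact h1.mono_set (prod_mono Ioc_subset_Icc_self subset_rfl)
    rw [IntegrableOn, ← Measure.prod_restrict, Measure.restrict_univ] at h2
    exact h2
  have hswap := intervalIntegral_integral_swap hprod
  simp only [intervalIntegral.integral_const_mul] at hswap
  have hcI : ContinuousOn (fun t => ∫ x, φ x * T (t, x) ∂μ) (Icc a b) :=
    continuousOn_integral_of_compact_support isCompact_univ hφT fun _ _ _ h => absurd (mem_univ _) h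
  have hcT : ContinuousOn (fun t => √(∫ x, T (t, x) ^ 2 ∂μ)) (Icc a b) :=
    (continuousOn_integral_of_compact_support (f := fun t x => T (t, x) ^ 2) isCompact_univ
      (show ContinuousOn (fun p => T p ^ 2) _ from hT.pow 2) fun _ _ _ h => absurd (mem_univ _) h).sqrt
  constructor
  · have h3 := hprod.integral_prod_right
    refine h3.congr (Eventually.of_forall fun x => ?_)
    simp only [Function.uncurry]
    rw [← intervalIntegral.integral_const_mul, intervalIntegral.integral_of_le hab, uIoc_of_le hab]
  · rw [← hswap, ← intervalIntegral.integral_const_mul]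
    refine intervalIntegral.integral_mono_on hab (hcI.intervalIntegrable_of_Icc hab)
      ((hcT.intervalIntegrable_of_Icc hab).const_mul _) fun t ht => ?_
    have ht' := hcont t ht
    exact integral_mul_le_sqrt_mul_sqrt (hint (hφ.pow 2)) (hint (ht'.pow 2))
      (hint (hφ.mul ht'))

section LowerBound

variable {n r : ℕ} {M : Type*} [TopologicalSpace M] [ChartedSpace (EuclideanSpace ℝ (Fin n)) M]
  {V : M → Type*} [TopologicalSpace (TotalSpace (EuclideanSpace ℂ (Fin r)) V)]
  [∀ x, TopologicalSpace (V x)] [∀ x, AddCommGroup (V x)] [∀ x, Module ℂ (V x)]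
  [FiberBundle (EuclideanSpace ℂ (Fin r)) V] [VectorBundle ℂ (EuclideanSpace ℂ (Fin r)) V]
  [IsManifold (𝓡 n) ∞ M] [MeasurableSpace M] [BorelSpace M] [CompactSpace M]
  [T2Space M]

set_option linter.unusedSectionVars false

theorem IsC1On.continuousOn_sqrt_l2Inner (g : SmoothRiemannianMetric n M) (α : ℝ)
    {γ v : ℝ → HermSection n r V} {a b : ℝ} (hγ : IsC1On γ v a b)
    (hpos : ∀ t ∈ Icc a b, ∀ x, ((γ t).1 x).IsPosDef) :
    ContinuousOn (fun t => √(l2Inner g (fun _ => α) (γ t) (v t) (v t))) (Icc a b) :=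
  (continuousOn_integral_of_compact_support isCompact_univ (hγ.continuousOn_innerAt hpos α)
    fun _ _ _ h => absurd (mem_univ _) h).sqrt

/-- On one `C¹` piece the change of `logDet` at each point is the time integral of the trace. Fubini
and Cauchy–Schwarz bound its pairing with `φ` by the `L²` norms of the trace, and the pointwise
estimate bounds those by the speed. -/
theorem IsC1On.integral_mul_logDet_le (hr : 0 < r) (g : SmoothRiemannianMetric n M) {α : ℝ}
    (hα : 0 ≤ 1 / (r : ℝ) + α)
    {γ v : ℝ → HermSection n r V} {a b : ℝ} (hab : a ≤ b) (hγ : IsC1On γ v a b)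
    (hpos : ∀ t ∈ Icc a b, ∀ x, ((γ t).1 x).IsPosDef) {φ : M → ℝ} (hφ : Continuous φ) :
    Integrable (fun x => φ x * (logDet (γ b) x - logDet (γ a) x)) (riemannianVolume g) ∧
      √(1 / (r : ℝ) + α) *
          ∫ x, φ x * (logDet (γ b) x - logDet (γ a) x) ∂(riemannianVolume g) ≤
        √(∫ x, φ x ^ 2 ∂(riemannianVolume g)) *
          ∫ t in a..b, √(l2Inner g (fun _ => α) (γ t) (v t) (v t)) := by
  have : SecondCountableTopology M :=
    ChartedSpace.secondCountable_of_sigmaCompact (EuclideanSpace ℝ (Fin n)) M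
  have : Nonempty (Fin r) := ⟨⟨0, hr⟩⟩
  set T : ℝ × M → ℝ := fun p => (LinearMap.trace ℂ (V p.2)
      (((γ p.1).1 p.2).invMul ((v p.1).1 p.2))).re with hTdef
  have hT : ContinuousOn T (Icc a b ×ˢ univ) := hγ.continuousOn_trace hpos
  have hcont : ∀ x, ContinuousOn (fun t => T (t, x)) (Icc a b) := fun x =>
    hT.comp (by fun_prop) fun t ht => ⟨ht, mem_univ _⟩
  have hftc : ∀ x, logDet (γ b) x - logDet (γ a) x = ∫ t in a..b, T (t, x) := by
    intro x
    refine (intervalIntegral.integral_eq_sub_of_hasDerivAt_of_le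
      (f := fun t => logDet (γ t) x) hab
      (fun t ht => (hγ.hasDerivWithinAt_logDet hpos x ht).continuousWithinAt) (fun t ht => ?_)
      ((hcont x).intervalIntegrable_of_Icc hab)).symm
    exact (hγ.hasDerivWithinAt_logDet hpos x (Ioo_subset_Icc_self ht)).hasDerivAt
      (Icc_mem_nhds ht.1 ht.2)
  obtain ⟨h1, h2⟩ := integral_mul_intervalIntegral_le (μ := riemannianVolume g) hab hT hφ
  simp only [hftc]
  refine ⟨h1, (mul_le_mul_of_nonneg_left h2 (Real.sqrt_nonneg _)).trans ?_⟩
  rw [mul_left_comm, ← intervalIntegral.integral_const_mul]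
  refine mul_le_mul_of_nonneg_left ?_ (Real.sqrt_nonneg _)
  have hcT : ContinuousOn (fun t => √(∫ x, T (t, x) ^ 2 ∂(riemannianVolume g))) (Icc a b) :=
    (continuousOn_integral_of_compact_support (f := fun t x => T (t, x) ^ 2) isCompact_univ
      (show ContinuousOn (fun p => T p ^ 2) _ from hT.pow 2) fun _ _ _ h => absurd (mem_univ _) h).sqrt
  refine intervalIntegral.integral_mono_on hab
    ((hcT.intervalIntegrable_of_Icc hab).const_mul _)
    ((hγ.continuousOn_sqrt_l2Inner g α hpos).intervalIntegrable_of_Icc hab) fun t ht => ?_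
  rw [← Real.sqrt_mul hα, ← integral_const_mul]
  refine Real.sqrt_le_sqrt ?_
  have hint : ∀ {ψ : M → ℝ}, Continuous ψ → Integrable ψ (riemannianVolume g) := fun h =>
    integrableOn_univ.1 (h.continuousOn.integrableOn_compact isCompact_univ)
  have hTt : Continuous fun x => T (t, x) :=
    hT.comp_continuous (by fun_prop) fun x => ⟨ht, mem_univ _⟩
  have hIt : Continuous fun x => SesqForm.innerAt α ((γ t).1 x) ((v t).1 x) ((v t).1 x) :=
    (hγ.continuousOn_innerAt hpos α).comp_continuous (f := fun x => (t, x)) (by fun_prop)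
      fun x => ⟨ht, mem_univ _⟩
  refine integral_mono (hint (continuous_const.mul (hTt.pow 2))) (hint hIt) fun x => ?_
  have hxe := FiberBundle.mem_baseSet_trivializationAt' (F := EuclideanSpace ℂ (Fin r)) (E := V) x
  have h3 := SesqForm.le_innerAt (hpos t ht x) ((γ t).2.1 x) ((v t).2.1 x) α (localFrame _ hxe)
  rwa [Fintype.card_fin] at h3

theorem HermPath.length_nonneg (g : SmoothRiemannianMetric n M) (α : M → ℝ)
    {h₀ h₁ : HermMetric n r V} (γ : HermPath h₀ h₁) : 0 ≤ γ.length g α :=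
  intervalIntegral.integral_nonneg zero_le_one fun _ _ => Real.sqrt_nonneg _

theorem monotone_breaks {N : ℕ} {τ : ℕ → ℝ} (h : ∀ k < N, τ k < τ (k + 1)) {j k : ℕ}
    (hjk : j ≤ k) (hk : k ≤ N) : τ j ≤ τ k := by
  induction k, hjk using Nat.le_induction with
  | base => exact le_rfl
  | succ k _ ih => exact (ih (by omega)).trans (h k (by omega)).le

/-- The length of a path from `h₀` to `h₁` controls the change of the determinant. -/
theorem HermPath.integral_mul_logDet_le_length (hr : 0 < r) (g : SmoothRiemannianMetric n M) {α : ℝ}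
    (hα : 0 ≤ 1 / (r : ℝ) + α) {h₀ h₁ : HermMetric n r V} (γ : HermPath h₀ h₁) {φ : M → ℝ}
    (hφ : Continuous φ) :
    √(1 / (r : ℝ) + α) *
        ∫ x, φ x * (logDet h₁.form x - logDet h₀.form x) ∂(riemannianVolume g) ≤
      √(∫ x, φ x ^ 2 ∂(riemannianVolume g)) * γ.length g (fun _ => α) := by
  obtain ⟨N, τ, h0, hN, hτ⟩ := γ.piecewise
  have hlt : ∀ k < N, τ k < τ (k + 1) := fun k hk => (hτ k hk).1
  have hsub : ∀ k < N, Icc (τ k) (τ (k + 1)) ⊆ Icc 0 1 := fun k hk =>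
    Icc_subset_Icc (h0 ▸ monotone_breaks hlt (Nat.zero_le k) hk.le)
      (hN ▸ monotone_breaks hlt hk le_rfl)
  set ℓ : ℝ → ℝ := fun t =>
    √(l2Inner g (fun _ => α) (γ.toFun t) (γ.velocity t) (γ.velocity t)) with hℓ
  have key : ∀ k < N, IntervalIntegrable ℓ volume (τ k) (τ (k + 1)) ∧
      Integrable (fun x => φ x * (logDet (γ.toFun (τ (k + 1))) x - logDet (γ.toFun (τ k)) x))
        (riemannianVolume g) ∧
      √(1 / (r : ℝ) + α) * ∫ x, φ x * (logDet (γ.toFun (τ (k + 1))) x -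
          logDet (γ.toFun (τ k)) x) ∂(riemannianVolume g) ≤
        √(∫ x, φ x ^ 2 ∂(riemannianVolume g)) * ∫ t in τ k..τ (k + 1), ℓ t := by
    intro k hk
    obtain ⟨hk1, v, hv, hvel⟩ := hτ k hk
    have hpos : ∀ t ∈ Icc (τ k) (τ (k + 1)), ∀ x, ((γ.toFun t).1 x).IsPosDef := fun t ht =>
      γ.isPosDef t (hsub k hk ht)
    -- The velocity is prescribed only between break points, so the integrands are compared off a
    -- null set.
    have hae : ∀ᵐ t, t ∈ uIoc (τ k) (τ (k + 1)) →
        √(l2Inner g (fun _ => α) (γ.toFun t) (v t) (v t)) = ℓ t := by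
      filter_upwards [compl_mem_ae_iff.2 (measure_singleton (τ (k + 1)))] with t ht ht'
      rw [uIoc_of_le hk1.le] at ht'
      simp only [hℓ]
      rw [hvel ⟨ht'.1, lt_of_le_of_ne ht'.2 ht⟩]
    have hle := hv.integral_mul_logDet_le hr g hα hk1.le hpos hφ
    refine ⟨?_, hle.1, ?_⟩
    · exact ((hv.continuousOn_sqrt_l2Inner g α hpos).intervalIntegrable_of_Icc hk1.le).congr_ae
        ((ae_restrict_iff' measurableSet_uIoc).2 hae)
    · rw [← intervalIntegral.integral_congr_ae hae]
      exact hle.2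
  have hsum := intervalIntegral.sum_integral_adjacent_intervals fun k hk => (key k hk).1
  rw [h0, hN] at hsum
  -- The pairing is linear in the change of `logDet`, so the estimates on the pieces telescope.
  have htel : ∀ x, φ x * (logDet h₁.form x - logDet h₀.form x) = ∑ k ∈ Finset.range N,
      φ x * (logDet (γ.toFun (τ (k + 1))) x - logDet (γ.toFun (τ k)) x) := by
    intro x
    rw [← Finset.mul_sum, Finset.sum_range_sub (fun k => logDet (γ.toFun (τ k)) x), h0, hN,
      γ.source, γ.target]
  simp only [htel]
  rw [integral_finsetSum _ fun k hk => (key k (Finset.mem_range.1 hk)).2.1, Finset.mul_sum,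
    HermPath.length, ← hsum, Finset.mul_sum]
  exact Finset.sum_le_sum fun k hk => (key k (Finset.mem_range.1 hk)).2.2

theorem HermPath.le_length_expMul (hr : 0 < r) (g : SmoothRiemannianMetric n M) {α : ℝ}
    (hα : -1 / (r : ℝ) < α) (h : HermMetric n r V) (f₁ f₂ : C^∞⟮𝓡 n, M; 𝓘(ℝ, ℝ), ℝ⟯)
    (γ : HermPath (h.expMul f₁) (h.expMul f₂)) :
    √(r * (1 + α * r)) * √(∫ x, (f₂ x - f₁ x) ^ 2 ∂(riemannianVolume g)) ≤
      γ.length g (fun _ => α) := by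
  have hr' : (0 : ℝ) < r := by exact_mod_cast hr
  have hα' : 0 ≤ 1 / (r : ℝ) + α := by
    rw [neg_div] at hα
    linarith
  have h1 := γ.integral_mul_logDet_le_length hr g hα' (φ := fun x => f₂ x - f₁ x)
    (f₂.contMDiff.continuous.sub f₁.contMDiff.continuous)
  have h2 : ∀ x, (f₂ x - f₁ x) * (logDet (h.expMul f₂).form x - logDet (h.expMul f₁).form x) =
      r * (f₂ x - f₁ x) ^ 2 := by
    intro x
    rw [logDet_expMul, logDet_expMul]
    ring
  simp only [h2] at h1
  rw [integral_const_mul] at h1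
  set A := ∫ x, (f₂ x - f₁ x) ^ 2 ∂(riemannianVolume g) with hA
  have hA0 : 0 ≤ A := integral_nonneg fun x => sq_nonneg _
  -- With `φ = f₂ - f₁` both sides carry a factor `√A`; it can be cancelled only when `A ≠ 0`.
  rcases hA0.eq_or_lt with hA1 | hA1
  · rw [← hA1]
    simpa using γ.length_nonneg g _
  · have h3 : √(r * (1 + α * r)) = √(1 / (r : ℝ) + α) * r := by
      have h5 : (r : ℝ) * (1 + α * r) = (1 / (r : ℝ) + α) * r ^ 2 := by field_simp
      rw [h5, Real.sqrt_mul hα', Real.sqrt_sq hr'.le]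
    rw [h3]
    have h4 : 0 < √A := Real.sqrt_pos.2 hA1
    refine le_of_mul_le_mul_left ?_ h4
    calc √A * (√(1 / (r : ℝ) + α) * r * √A) = √(1 / (r : ℝ) + α) * (r * (√A * √A)) := by ring
      _ = √(1 / (r : ℝ) + α) * (r * A) := by rw [Real.mul_self_sqrt hA0]
      _ ≤ _ := h1

end LowerBound

/-! ### The conformal geodesic -/

set_option synthInstance.maxHeartbeats 200000 in
/-- The partial derivatives in the second variable of a smooth function of two variables are
smooth functions of both variables. -/
theorem ContDiffOn.iteratedFDeriv_snd {E F : Type*} [NormedAddCommGroup E] [NormedSpace ℝ E]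
    [NormedAddCommGroup F] [NormedSpace ℝ F] {G : ℝ × E → F} {U : Set E} (hU : IsOpen U)
    (hG : ContDiffOn ℝ ∞ G (univ ×ˢ U)) (k : ℕ) :
    ContDiffOn ℝ ∞ (fun p : ℝ × E => iteratedFDeriv ℝ k (fun u => G (p.1, u)) p.2)
      (univ ×ˢ U) := by
  have hopen : IsOpen (univ ×ˢ U : Set (ℝ × E)) := isOpen_univ.prod hU
  induction k with
  | zero =>
    refine (((continuousMultilinearCurryFin0 ℝ E F).symm.contDiff (n := ∞)).comp_contDiffOn
      hG).congr fun p _ => ?_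
    rw [iteratedFDeriv_zero_eq_comp]
    rfl
  | succ k ih =>
    have h1 : ContDiffOn ℝ ∞
        (fun p : ℝ × E => fderiv ℝ (iteratedFDeriv ℝ k fun u => G (p.1, u)) p.2)
        (univ ×ˢ U) := by
      intro p hp
      refine ContDiffAt.contDiffWithinAt ?_
      refine ContDiffAt.fderiv (n := ∞) (f := fun (q : ℝ × E) (u : E) =>
        iteratedFDeriv ℝ k (fun u => G (q.1, u)) u) (g := Prod.snd) ?_ contDiffAt_snd (by simp)
      have h2 : ContDiffAt ℝ ∞
          (fun p : ℝ × E => iteratedFDeriv ℝ k (fun u => G (p.1, u)) p.2) (p.1, p.2) :=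
        ih.contDiffAt (hopen.mem_nhds hp)
      have h3 : ContDiffAt ℝ ∞ (fun q : (ℝ × E) × E => (q.1.1, q.2)) (p, p.2) := by fun_prop
      exact ContDiffAt.comp (p, p.2) h2 h3
    have h4 : ContDiff ℝ ∞
        (continuousMultilinearCurryLeftEquiv ℝ (fun _ : Fin (k + 1) => E) F).symm :=
      LinearIsometryEquiv.contDiff _
    refine (h4.comp_contDiffOn h1).congr fun p _ => ?_
    rw [iteratedFDeriv_succ_eq_comp_left]
    rfl

/-- The difference quotient `(eᶻ - 1) / z` is smooth. -/
theorem contDiff_dslope_exp : ContDiff ℝ ∞ (dslope Real.exp 0) := by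
  rw [contDiff_iff_contDiffAt]
  intro z
  rcases eq_or_ne z 0 with rfl | hz
  · obtain ⟨p, hp⟩ := analyticAt_rexp (x := 0)
    exact (hp.has_fpower_series_dslope_fslope).analyticAt.contDiffAt
  · have h1 : ContDiffAt ℝ ∞ (fun y : ℝ => (Real.exp y - 1) / y) z :=
      (Real.contDiff_exp.contDiffAt.sub contDiffAt_const).div contDiffAt_id hz
    refine h1.congr_of_eventuallyEq ?_
    filter_upwards [isOpen_ne.mem_nhds hz] with y hy
    rw [dslope_of_ne _ hy, slope_def_field, Real.exp_zero, sub_zero]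

theorem mul_dslope_exp (z : ℝ) : z * dslope Real.exp 0 z = Real.exp z - 1 := by
  have := sub_smul_dslope Real.exp 0 z
  simpa using this

/-! ### Convergence in the smooth compact-open topology. -/

section UpperBound

variable {n r : ℕ} {M : Type*} [TopologicalSpace M] [ChartedSpace (EuclideanSpace ℝ (Fin n)) M]
  {V : M → Type*} [TopologicalSpace (TotalSpace (EuclideanSpace ℂ (Fin r)) V)]
  [∀ x, TopologicalSpace (V x)] [∀ x, AddCommGroup (V x)] [∀ x, Module ℂ (V x)]
  [FiberBundle (EuclideanSpace ℂ (Fin r)) V] [VectorBundle ℂ (EuclideanSpace ℂ (Fin r)) V]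

set_option linter.unusedSectionVars false

/-- A curve of sections whose coordinate expressions depend smoothly on the parameter and the
coordinates converges in the smooth compact-open topology. -/
theorem HermSection.tendsto_of_contDiffOn {σ : ℝ → HermSection n r V} {s₀ : HermSection n r V}
    {l : Filter ℝ} {t : ℝ} (hl : l ≤ 𝓝 t)
    (H : ∀ e ∈ FiberBundle.trivializationAtlas (EuclideanSpace ℂ (Fin r)) V, ∀ (p : M)
      (i j : Fin r), ∃ G : ℝ × EuclideanSpace ℝ (Fin n) → ℂ,
        ContDiffOn ℝ ∞ G (univ ×ˢ coordDomain n e p) ∧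
        (∀ᶠ s in l, ∀ u ∈ coordDomain n e p,
          localEntry e i j (σ s).1 ((chartAt (EuclideanSpace ℝ (Fin n)) p).symm u) = G (s, u)) ∧
        ∀ u ∈ coordDomain n e p,
          localEntry e i j s₀.1 ((chartAt (EuclideanSpace ℝ (Fin n)) p).symm u) = G (t, u)) :
    Tendsto σ l (𝓝 s₀) := by
  rw [HermSection.instTopologicalSpace]
  simp only [nhds_iInf, nhds_induced, tendsto_iInf, tendsto_comap_iff]
  rintro ⟨e, he⟩ p i j k
  rw [UniformOnFun.tendsto_iff_tendstoUniformlyOn]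
  rintro K ⟨hK, hKU⟩
  obtain ⟨G, hG, hσ, hs₀⟩ := H e he p i j
  have hopen := isOpen_coordDomain (n := n) e p
  have hD := (hG.iteratedFDeriv_snd hopen k).continuousOn
  have hcongr : ∀ {s : HermSection n r V} {τ : ℝ}, (∀ u ∈ coordDomain n e p,
      localEntry e i j s.1 ((chartAt (EuclideanSpace ℝ (Fin n)) p).symm u) = G (τ, u)) →
      ∀ u ∈ coordDomain n e p, iteratedFDeriv ℝ k (fun u =>
        localEntry e i j s.1 ((chartAt (EuclideanSpace ℝ (Fin n)) p).symm u)) u =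
        iteratedFDeriv ℝ k (fun u => G (τ, u)) u := by
    intro s τ h u hu
    refine (Filter.EventuallyEq.iteratedFDeriv ℝ (f₂ := fun u => G (τ, u)) ?_ k).eq_of_nhds
    filter_upwards [hopen.mem_nhds hu] with w hw using h w hw
  intro W hW
  -- Compactness of `K` turns joint continuity of the `k`-th derivative into uniform closeness on
  -- `K` for parameters near `t`.
  obtain ⟨v, hv, hvW⟩ := hK.mem_uniformity_of_prod (q := t) (s := univ)
    (f := fun (s : ℝ) u => iteratedFDeriv ℝ k (fun u => G (s, u)) u)
    (hD.mono (prod_mono_right hKU)) (mem_univ t) (symm_le_uniformity hW)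
  rw [nhdsWithin_univ] at hv
  filter_upwards [hσ, hl hv] with s hs hsv u hu
  simp only [UniformOnFun.toFun_ofFun, Function.comp_apply]
  rw [hcongr hs u (hKU hu), hcongr hs₀ u (hKU hu)]
  exact hvW s hsv u hu

theorem contDiffOn_localEntry_chart (s : HermSection n r V)
    [IsManifold (𝓡 n) ∞ M]
    {e : Trivialization (EuclideanSpace ℂ (Fin r)) (π (EuclideanSpace ℂ (Fin r)) V)}
    (he : e ∈ FiberBundle.trivializationAtlas (EuclideanSpace ℂ (Fin r)) V) (p : M)
    (i j : Fin r) :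
    ContDiffOn ℝ ∞ (fun u => localEntry e i j s.1 ((chartAt (EuclideanSpace ℝ (Fin n)) p).symm u))
      (coordDomain n e p) := by
  rw [← contMDiffOn_iff_contDiffOn]
  exact (s.2.2 e he i j).comp ((contMDiffOn_chart_symm (I := 𝓡 n)).mono inter_subset_left)
    fun u hu => hu.2

theorem contDiffOn_comp_chart [IsManifold (𝓡 n) ∞ M] (f : C^∞⟮𝓡 n, M; 𝓘(ℝ, ℝ), ℝ⟯) (p : M) :
    ContDiffOn ℝ ∞ (fun u => f ((chartAt (EuclideanSpace ℝ (Fin n)) p).symm u))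
      (chartAt (EuclideanSpace ℝ (Fin n)) p).target := by
  rw [← contMDiffOn_iff_contDiffOn]
  exact f.contMDiff.comp_contMDiffOn (contMDiffOn_chart_symm (I := 𝓡 n))

/-- Multiplication of a section by a smooth function. -/
def HermSection.mulFun (f : C^∞⟮𝓡 n, M; 𝓘(ℝ, ℝ), ℝ⟯) (s : HermSection n r V) :
    HermSection n r V :=
  ⟨fun x => f x • s.1 x, fun x a b => by
    simp only [LinearMap.smul_apply, Complex.real_smul, map_mul, Complex.conj_ofReal]
    rw [s.2.1 x a b], fun e he i j => f.contMDiff.contMDiffOn.smul (s.2.2 e he i j)⟩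

/-! ### The conformal path and its length. -/

section Conformal

variable [IsManifold (𝓡 n) ∞ M] (h : HermMetric n r V) (f₁ f₂ : C^∞⟮𝓡 n, M; 𝓘(ℝ, ℝ), ℝ⟯)

/-- The curve `t ↦ e^{f₁ + t (f₂ - f₁)} h`. -/
def conformalCurve (t : ℝ) : HermSection n r V := (h.expMul (f₁ + t • (f₂ - f₁))).form

theorem localEntry_conformalCurve
    (e : Trivialization (EuclideanSpace ℂ (Fin r)) (π (EuclideanSpace ℂ (Fin r)) V))
    (i j : Fin r) (t : ℝ) (x : M) :
    localEntry e i j (conformalCurve h f₁ f₂ t).1 x =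
      ((Real.exp (f₁ x + t * (f₂ x - f₁ x)) : ℝ) : ℂ) * localEntry e i j h.form.1 x := by
  simp [conformalCurve, HermMetric.expMul, localEntry]

theorem localEntry_mulFun
    (e : Trivialization (EuclideanSpace ℂ (Fin r)) (π (EuclideanSpace ℂ (Fin r)) V))
    (i j : Fin r) (f : C^∞⟮𝓡 n, M; 𝓘(ℝ, ℝ), ℝ⟯) (s : HermSection n r V) (x : M) :
    localEntry e i j (s.mulFun f).1 x = (f x : ℂ) * localEntry e i j s.1 x := by
  simp [HermSection.mulFun, localEntry]

/-- With `φ = f₂ - f₁`, the difference quotient of the exponential factor is `e^{f₁ + tφ} φ E((s -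
t) φ)`, where `E(z) = (eᶻ - 1) / z`. As `E` is smooth across `0`, this is smooth in `(s, u)` up to
`s = t`, so all derivatives in `u` converge uniformly on compact sets. -/
theorem isC1On_conformalCurve (a b : ℝ) :
    IsC1On (conformalCurve h f₁ f₂)
      (fun t => (conformalCurve h f₁ f₂ t).mulFun (f₂ - f₁)) a b := by
  have hφ : ∀ p : M, ContDiffOn ℝ ∞ (fun q : ℝ × EuclideanSpace ℝ (Fin n) =>
      (f₂ - f₁) ((chartAt (EuclideanSpace ℝ (Fin n)) p).symm q.2))
      (univ ×ˢ (chartAt (EuclideanSpace ℝ (Fin n)) p).target) := fun p =>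
    (contDiffOn_comp_chart (f₂ - f₁) p).comp contDiffOn_snd fun q hq => hq.2
  have hf : ∀ p : M, ContDiffOn ℝ ∞ (fun q : ℝ × EuclideanSpace ℝ (Fin n) =>
      f₁ ((chartAt (EuclideanSpace ℝ (Fin n)) p).symm q.2))
      (univ ×ˢ (chartAt (EuclideanSpace ℝ (Fin n)) p).target) := fun p =>
    (contDiffOn_comp_chart f₁ p).comp contDiffOn_snd fun q hq => hq.2
  have hh : ∀ e ∈ FiberBundle.trivializationAtlas (EuclideanSpace ℂ (Fin r)) V, ∀ (p : M)
      (i j : Fin r), ContDiffOn ℝ ∞ (fun q : ℝ × EuclideanSpace ℝ (Fin n) =>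
      localEntry e i j h.form.1 ((chartAt (EuclideanSpace ℝ (Fin n)) p).symm q.2))
      (univ ×ˢ coordDomain n e p) := fun e he p i j =>
    (contDiffOn_localEntry_chart h.form he p i j).comp contDiffOn_snd fun q hq => hq.2
  have hsub : ∀ (e : Trivialization (EuclideanSpace ℂ (Fin r)) (π (EuclideanSpace ℂ (Fin r)) V))
      (p : M), (univ ×ˢ coordDomain n e p : Set (ℝ × EuclideanSpace ℝ (Fin n))) ⊆
        univ ×ˢ (chartAt (EuclideanSpace ℝ (Fin n)) p).target := fun e p =>
    prod_mono_right inter_subset_left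
  have hof : ContDiff ℝ ∞ (fun y : ℝ => (y : ℂ)) := Complex.ofRealCLM.contDiff
  refine ⟨fun t _ => ?_, fun t _ => ?_⟩
  · refine HermSection.tendsto_of_contDiffOn (t := t) nhdsWithin_le_nhds fun e he p i j =>
      ⟨fun q => ((Real.exp (f₁ ((chartAt (EuclideanSpace ℝ (Fin n)) p).symm q.2) +
          t * (f₂ - f₁) ((chartAt (EuclideanSpace ℝ (Fin n)) p).symm q.2)) *
        ((f₂ - f₁) ((chartAt (EuclideanSpace ℝ (Fin n)) p).symm q.2) *
          dslope Real.exp 0 ((q.1 - t) *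
            (f₂ - f₁) ((chartAt (EuclideanSpace ℝ (Fin n)) p).symm q.2))) : ℝ) : ℂ) *
        localEntry e i j h.form.1 ((chartAt (EuclideanSpace ℝ (Fin n)) p).symm q.2), ?_, ?_, ?_⟩
    · have hφ' := (hφ p).mono (hsub e p)
      have hf' := (hf p).mono (hsub e p)
      refine (hof.comp_contDiffOn (ContDiffOn.mul ?_ (hφ'.mul ?_))).mul (hh e he p i j)
      · exact Real.contDiff_exp.comp_contDiffOn (hf'.add (contDiffOn_const.mul hφ'))
      · exact contDiff_dslope_exp.comp_contDiffOn
          ((contDiffOn_fst.sub contDiffOn_const).mul hφ')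
    · filter_upwards [self_mem_nhdsWithin] with s hs u hu
      have hst : s - t ≠ 0 := sub_ne_zero.2 hs.2
      have h1 : localEntry e i j (slope (conformalCurve h f₁ f₂) t s).1
          ((chartAt (EuclideanSpace ℝ (Fin n)) p).symm u) =
          (((s - t)⁻¹ : ℝ) : ℂ) * (localEntry e i j (conformalCurve h f₁ f₂ s).1
            ((chartAt (EuclideanSpace ℝ (Fin n)) p).symm u) -
            localEntry e i j (conformalCurve h f₁ f₂ t).1
            ((chartAt (EuclideanSpace ℝ (Fin n)) p).symm u)) := by
        simp [slope, localEntry]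
      rw [h1, localEntry_conformalCurve, localEntry_conformalCurve, ← sub_mul, ← mul_assoc]
      congr 1
      rw [← Complex.ofReal_sub, ← Complex.ofReal_mul]
      congr 1
      set y := (chartAt (EuclideanSpace ℝ (Fin n)) p).symm u
      have hy : (f₂ - f₁) y = f₂ y - f₁ y := rfl
      rw [hy]
      have h2 := mul_dslope_exp ((s - t) * (f₂ y - f₁ y))
      have h3 : f₁ y + s * (f₂ y - f₁ y) =
          (f₁ y + t * (f₂ y - f₁ y)) + (s - t) * (f₂ y - f₁ y) := by ring
      rw [h3, Real.exp_add _ ((s - t) * (f₂ y - f₁ y)), inv_mul_eq_iff_eq_mul₀ hst]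
      linear_combination (-Real.exp (f₁ y + t * (f₂ y - f₁ y))) * h2
    · intro u hu
      rw [localEntry_mulFun, localEntry_conformalCurve, ← mul_assoc]
      congr 1
      have h1 : dslope Real.exp 0 0 = 1 := by simp
      simp only [sub_self, zero_mul, h1, mul_one]
      rw [← Complex.ofReal_mul, mul_comm]
      rfl
  · refine HermSection.tendsto_of_contDiffOn (t := t) nhdsWithin_le_nhds fun e he p i j =>
      ⟨fun q => (((f₂ - f₁) ((chartAt (EuclideanSpace ℝ (Fin n)) p).symm q.2) *
        Real.exp (f₁ ((chartAt (EuclideanSpace ℝ (Fin n)) p).symm q.2) +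
          q.1 * (f₂ - f₁) ((chartAt (EuclideanSpace ℝ (Fin n)) p).symm q.2)) : ℝ) : ℂ) *
        localEntry e i j h.form.1 ((chartAt (EuclideanSpace ℝ (Fin n)) p).symm q.2), ?_, ?_, ?_⟩
    · have hφ' := (hφ p).mono (hsub e p)
      have hf' := (hf p).mono (hsub e p)
      refine (hof.comp_contDiffOn (hφ'.mul ?_)).mul (hh e he p i j)
      exact Real.contDiff_exp.comp_contDiffOn (hf'.add (contDiffOn_fst.mul hφ'))
    · refine Eventually.of_forall fun s u _ => ?_
      rw [localEntry_mulFun, localEntry_conformalCurve, ← mul_assoc, ← Complex.ofReal_mul]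
      rfl
    · intro u _
      rw [localEntry_mulFun, localEntry_conformalCurve, ← mul_assoc, ← Complex.ofReal_mul]
      rfl

/-- The path `t ↦ e^{(1 - t) f₁ + t f₂} h` from `e^{f₁} h` to `e^{f₂} h`. -/
def conformalPath : HermPath (h.expMul f₁) (h.expMul f₂) where
  toFun := conformalCurve h f₁ f₂
  velocity t := (conformalCurve h f₁ f₂ t).mulFun (f₂ - f₁)
  source := by simp [conformalCurve]
  target := by simp [conformalCurve]
  isPosDef t _ := (h.expMul (f₁ + t • (f₂ - f₁))).isPosDef
  piecewise := ⟨1, fun k => k, by simp, by simp, fun k _ => ⟨by simp, _,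
    isC1On_conformalCurve h f₁ f₂ _ _, fun _ _ => rfl⟩⟩

/-- Here `h⁻¹v` is `f₂ - f₁` times the identity of an `r`-dimensional space, giving `r + α r²` as
the constant. The value does not involve `t`, so the path has constant speed. -/
theorem innerAt_conformalCurve (α t : ℝ) (x : M) :
    SesqForm.innerAt α ((conformalCurve h f₁ f₂ t).1 x)
      (((conformalCurve h f₁ f₂ t).mulFun (f₂ - f₁)).1 x)
      (((conformalCurve h f₁ f₂ t).mulFun (f₂ - f₁)).1 x) =
      (r * (1 + α * r)) * (f₂ x - f₁ x) ^ 2 := by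
  have hxe := FiberBundle.mem_baseSet_trivializationAt' (F := EuclideanSpace ℂ (Fin r)) (E := V) x
  have b := localFrame (trivializationAt (EuclideanSpace ℂ (Fin r)) V x) hxe
  have : FiniteDimensional ℂ (V x) := b.finiteDimensional_of_finite
  have hrank : Module.finrank ℂ (V x) = r := by
    rw [Module.finrank_eq_card_basis b, Fintype.card_fin]
  set k := Real.exp ((f₁ + t • (f₂ - f₁)) x) with hk
  have h1 : (conformalCurve h f₁ f₂ t).1 x = k • h.form.1 x := rfl
  have h2 : ((conformalCurve h f₁ f₂ t).mulFun (f₂ - f₁)).1 x =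
      ((f₂ x - f₁ x) * k) • h.form.1 x := by
    rw [mul_smul]
    rfl
  have h3 := SesqForm.invMul_smul_self (h.isPosDef x) (f₂ x - f₁ x) (k := k) (Real.exp_pos _)
  rw [SesqForm.innerAt, h1, h2, h3, smul_mul_smul_comm, mul_one, map_smul, map_smul,
    LinearMap.trace_one, hrank]
  simp only [smul_eq_mul, ← Complex.ofReal_mul, Complex.re_ofReal_mul, Complex.natCast_re]
  ring

theorem length_conformalPath [MeasurableSpace M] (g : SmoothRiemannianMetric n M) {α : ℝ}
    (hα : 0 ≤ r * (1 + α * r)) :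
    (conformalPath h f₁ f₂).length g (fun _ => α) =
      √(r * (1 + α * r)) * √(∫ x, (f₂ x - f₁ x) ^ 2 ∂(riemannianVolume g)) := by
  have h1 : ∀ t, l2Inner g (fun _ => α) ((conformalPath h f₁ f₂).toFun t)
      ((conformalPath h f₁ f₂).velocity t) ((conformalPath h f₁ f₂).velocity t) =
      (r * (1 + α * r)) * ∫ x, (f₂ x - f₁ x) ^ 2 ∂(riemannianVolume g) := by
    intro t
    rw [l2Inner, ← integral_const_mul]
    exact integral_congr_ae (Eventually.of_forall fun x => innerAt_conformalCurve h f₁ f₂ α t x)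
  simp only [HermPath.length, h1, intervalIntegral.integral_const, sub_zero, one_smul]
  rw [Real.sqrt_mul hα]

end Conformal

end UpperBound

end

/-! ### The distance between conformally related metrics. -/

theorem corollary4p4 {n r : ℕ} (hr : 0 < r)
    {M : Type*} [TopologicalSpace M] [T2Space M] [CompactSpace M]
    [ChartedSpace (EuclideanSpace ℝ (Fin n)) M] [IsManifold (𝓡 n) ∞ M]
    [MeasurableSpace M] [BorelSpace M]
    (g : SmoothRiemannianMetric n M)
    {V : M → Type*} [TopologicalSpace (TotalSpace (EuclideanSpace ℂ (Fin r)) V)]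
    [∀ x, TopologicalSpace (V x)] [∀ x, AddCommGroup (V x)] [∀ x, Module ℂ (V x)]
    [FiberBundle (EuclideanSpace ℂ (Fin r)) V] [VectorBundle ℂ (EuclideanSpace ℂ (Fin r)) V]
    [IsSmoothComplexVectorBundle n r V]
    (α : ℝ) (hα : -1 / (r : ℝ) < α)
    (h : HermMetric n r V) (f₁ f₂ : C^∞⟮𝓡 n, M; 𝓘(ℝ, ℝ), ℝ⟯) :
    hermDist g (fun _ => α) (h.expMul f₁) (h.expMul f₂) =
      Real.sqrt (r * (1 + α * r)) *
        (eLpNorm (fun x => f₁ x - f₂ x) 2 (riemannianVolume g)).toReal := by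
  have hr' : (0 : ℝ) < r := by exact_mod_cast hr
  have hα' : 0 ≤ (r : ℝ) * (1 + α * r) := by
    rw [div_lt_iff₀ hr'] at hα
    exact mul_nonneg hr'.le (by linarith)
  have hnorm : (eLpNorm (fun x => f₁ x - f₂ x) 2 (riemannianVolume g)).toReal =
      √(∫ x, (f₂ x - f₁ x) ^ 2 ∂(riemannianVolume g)) := by
    have hcont : Continuous fun x => f₁ x - f₂ x :=
      f₁.contMDiff.continuous.sub f₂.contMDiff.continuous
    have hsq : Integrable (fun x => (f₁ x - f₂ x) ^ 2) (riemannianVolume g) :=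
      integrableOn_univ.1 ((hcont.pow 2).continuousOn.integrableOn_compact isCompact_univ)
    have hmem : MemLp (fun x => f₁ x - f₂ x) 2 (riemannianVolume g) :=
      (memLp_two_iff_integrable_sq hcont.aestronglyMeasurable).2 hsq
    rw [hmem.eLpNorm_eq_integral_rpow_norm (by norm_num) (by norm_num),
      ENNReal.toReal_ofReal (by positivity), Real.sqrt_eq_rpow]
    simp only [ENNReal.toReal_ofNat, Real.rpow_ofNat, Real.norm_eq_abs, sq_abs, one_div]
    congr 2 with x
    ring
  rw [hnorm, ← length_conformalPath h f₁ f₂ g hα']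
  -- A real infimum needs a lower bound, here `0`, for the first inequality and a nonempty index
  -- type for the second; the conformal path supplies the latter.
  refine le_antisymm (ciInf_le ⟨0, ?_⟩ (conformalPath h f₁ f₂)) ?_
  · rintro _ ⟨γ, rfl⟩
    exact γ.length_nonneg g _
  · have : Nonempty (HermPath (h.expMul f₁) (h.expMul f₂)) := ⟨conformalPath h f₁ f₂⟩
    refine le_ciInf fun γ => ?_
    rw [length_conformalPath h f₁ f₂ g hα']
    exact γ.le_length_expMul hr g hα h f₁ f₂
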